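/- Let $B$ be a complex manifold and let $\pi\colon\Sigma\to B$ be a family of compact Riemann surfaces, i.e. a proper holomorphic submersion of complex manifolds whose fibres are connected of dimension $1$. Let $\sigma\colon B\to\Sigma$ be a holomorphic section of $\pi$, let $k\ge 0$ be an integer, and let $\mathfrak t$ be a complex vector space of finite dimension $r$ (for instance a Cartan subalgebra of a finite-dimensional complex reductive Lie algebra). For a holomorphic map $\varphi\colon B'\to B$ of complex manifolds let $\Sigma'=B'\times_B\Sigma$ be the base change, with its section $\sigma'\colon B'\to\Sigma'$ induced by $\sigma$; let $\mathcal I_{\sigma'}\subset\mathcal O_{\Sigma'}$ be the ideal sheaf of holomorphic functions vanishing on $\sigma'(B')$, let $\mathcal O_{\Sigma'}(k\sigma')$ be the inverse of $\mathcal I_{\sigma'}^k$ (the sheaf of meromorphic functions with pole along $\sigma'(B')$ of order at most $k$ and no other poles), and put $$\mathcal T^{\le k}_{\Sigma',\sigma'}=\mathcal O_{\Sigma'}(k\sigma')/\mathcal O_{\Sigma'}.$$ Pullback of functions makes $$IT\colon\ (B'\to B)\ \longmapsto\ \Gamma\bigl(\Sigma',\ \mathfrak t\otimes_{\mathbb C}\mathcal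 T^{\le k}_{\Sigma',\sigma'}\bigr)$$ a contravariant functor on the category of complex manifolds over $B$. Then $IT$ is represented by a holomorphic vector bundle of rank $rk$ on $B$: there are a holomorphic vector bundle $V\to B$ of rank $rk$ and bijections $$\operatorname{Hom}_B(B',V)\ \cong\ \Gamma\bigl(\Sigma',\ \mathfrak t\otimes_{\mathbb C}\mathcal T^{\le k}_{\Sigma',\sigma'}\bigr),$$ natural in $B'\to B$, where $\operatorname{Hom}_B(B',V)$ is the set of holomorphic maps $B'\to V$ over $B$; moreover these bijections are $\mathbb C$-linear for the fibrewise vector space structure on $\operatorname{Hom}_B(B',V)$. -/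

import Mathlib

open CategoryTheory Opposite Manifold Topology Filter TensorProduct
open scoped ContDiff

universe u v

noncomputable section

/-- A complex manifold: a Hausdorff, second countable space with a holomorphic (analytic) atlas
modelled on a finite-dimensional complex vector space `E`, without boundary. -/
structure CplxMan where
  carrier : Type u
  E : Type
  H : Type
  [topCarrier : TopologicalSpace carrier]
  [t2 : T2Space carrier]
  [secondCountable : SecondCountableTopology carrier]
  [normedGroup : NormedAddCommGroup E]
  [normedSpace : NormedSpace ℂ E]
  [finiteDim : FiniteDimensional ℂ E]
  [topH : TopologicalSpace H]
  I : ModelWithCorners ℂ E H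
  [boundaryless : I.Boundaryless]
  [charted : ChartedSpace H carrier]
  [isManifold : IsManifold I ω carrier]

namespace CplxMan

instance : CoeSort CplxMan.{u} (Type u) := ⟨carrier⟩

attribute [instance] topCarrier t2 secondCountable normedGroup normedSpace finiteDim topH
  boundaryless charted isManifold

instance : Category.{u} CplxMan.{u} where
  Hom X Y := C^ω⟮X.I, X; Y.I, Y⟯
  id _ := ContMDiffMap.id
  comp f g := g.comp f

variable {X Y Z : CplxMan.{u}}

instance : FunLike (X ⟶ Y) X Y := inferInstanceAs (FunLike C^ω⟮X.I, X; Y.I, Y⟯ X Y)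

theorem contMDiff (f : X ⟶ Y) : ContMDiff X.I Y.I ω f := ContMDiffMap.contMDiff f

@[simp] theorem id_apply (x : X) : (𝟙 X : X ⟶ X) x = x := rfl
@[simp] theorem comp_apply (f : X ⟶ Y) (g : Y ⟶ Z) (x : X) : (f ≫ g) x = g (f x) := rfl

@[ext] theorem hom_ext {f g : X ⟶ Y} (h : ∀ x, f x = g x) : f = g := DFunLike.ext _ _ h

end CplxMan

section Division
variable {E : Type*} [NormedAddCommGroup E] [NormedSpace ℂ E]

/-- If `p` is the Taylor series of a function `h` on `E × ℂ`, this is the Taylor series of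
`(h (u, z) - h (u, 0)) / z`, written as a telescoping sum. -/
def divSeries (p : FormalMultilinearSeries ℂ (E × ℂ) ℂ) : FormalMultilinearSeries ℂ (E × ℂ) ℂ :=
  fun n => ∑ j : Fin (n + 1),
    ((p (n + 1)).curryMid j ((0 : E), (1 : ℂ))).compContinuousLinearMap
      (fun i => if i.castSucc < j then
        (ContinuousLinearMap.inl ℂ E ℂ).comp (ContinuousLinearMap.fst ℂ E ℂ)
        else ContinuousLinearMap.id ℂ (E × ℂ))

theorem norm_divSeries_le (p : FormalMultilinearSeries ℂ (E × ℂ) ℂ) (n : ℕ) :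
    ‖divSeries p n‖ ≤ (n + 1) * ‖p (n + 1)‖ := by
  have hP : ‖(ContinuousLinearMap.inl ℂ E ℂ).comp (ContinuousLinearMap.fst ℂ E ℂ)‖ ≤ 1 := by
    refine ContinuousLinearMap.opNorm_le_bound _ zero_le_one fun x => ?_
    simp [Prod.norm_def]
  have key : ∀ j : Fin (n + 1),
      ‖((p (n + 1)).curryMid j ((0 : E), (1 : ℂ))).compContinuousLinearMap
      (fun i => if i.castSucc < j then
        (ContinuousLinearMap.inl ℂ E ℂ).comp (ContinuousLinearMap.fst ℂ E ℂ)
        else ContinuousLinearMap.id ℂ (E × ℂ))‖ ≤ ‖p (n + 1)‖ := by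
    intro j
    refine (ContinuousMultilinearMap.norm_compContinuousLinearMap_le _ _).trans ?_
    have h1 : ∏ i : Fin n, ‖(if i.castSucc < j then
        (ContinuousLinearMap.inl ℂ E ℂ).comp (ContinuousLinearMap.fst ℂ E ℂ)
        else ContinuousLinearMap.id ℂ (E × ℂ))‖ ≤ 1 := by
      refine Finset.prod_le_one (fun _ _ => norm_nonneg _) fun i _ => ?_
      split_ifs
      · exact hP
      · exact ContinuousLinearMap.norm_id_le
    have h2 : ‖(p (n + 1)).curryMid j ((0 : E), (1 : ℂ))‖ ≤ ‖p (n + 1)‖ := by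
      refine (ContinuousLinearMap.le_opNorm _ _).trans ?_
      rw [ContinuousMultilinearMap.norm_curryMid]
      simp [Prod.norm_def]
    calc _ ≤ ‖p (n + 1)‖ * 1 := mul_le_mul h2 h1 (Finset.prod_nonneg fun _ _ => norm_nonneg _)
            (norm_nonneg _)
      _ = _ := mul_one _
  calc ‖divSeries p n‖ ≤ ∑ j : Fin (n + 1), ‖p (n + 1)‖ :=
        (norm_sum_le _ _).trans (Finset.sum_le_sum fun j _ => key j)
    _ = _ := by simp

theorem divSeries_radius_pos (p : FormalMultilinearSeries ℂ (E × ℂ) ℂ) (hp : 0 < p.radius) :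
    0 < (divSeries p).radius := by
  obtain ⟨C, r, hC, hr, h⟩ := p.le_mul_pow_of_radius_pos hp
  set s : NNReal := ⟨(2 * r)⁻¹, by positivity⟩ with hs
  have hs0 : 0 < s := by
    rw [← NNReal.coe_pos]; change 0 < (2 * r)⁻¹; positivity
  refine lt_of_lt_of_le (ENNReal.coe_pos.2 hs0)
    ((divSeries p).le_radius_of_bound (C * r * 1) fun n => ?_)
  have h1 := (norm_divSeries_le p n).trans
    (mul_le_mul_of_nonneg_left (h (n + 1)) (by positivity : (0 : ℝ) ≤ n + 1))
  have h2 : ((n : ℝ) + 1) ≤ 2 ^ n := by exact_mod_cast Nat.lt_two_pow_self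
  have h3 : (s : ℝ) = (2 * r)⁻¹ := rfl
  calc ‖divSeries p n‖ * (s : ℝ) ^ n
      ≤ ((n + 1) * (C * r ^ (n + 1))) * (s : ℝ) ^ n :=
        mul_le_mul_of_nonneg_right h1 (by positivity)
    _ = C * r * ((n + 1) / 2 ^ n) := by
        rw [h3, mul_inv, mul_pow, inv_pow, inv_pow, pow_succ]; field_simp
    _ ≤ C * r * 1 := by
        refine mul_le_mul_of_nonneg_left ?_ (by positivity)
        rw [div_le_one (by positivity)]; exact h2

theorem snd_mul_divSeries (p : FormalMultilinearSeries ℂ (E × ℂ) ℂ) (n : ℕ) (v : E × ℂ) :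
    v.2 * divSeries p n (fun _ => v) =
      p (n + 1) (fun _ => v) - p (n + 1) (fun _ => (v.1, 0)) := by
  set F : ℕ → ℂ := fun j => p (n + 1) (fun i => if (i : ℕ) < j then (v.1, 0) else v) with hF
  have h0 : F 0 = p (n + 1) (fun _ => v) := by simp [hF]
  have h1 : F (n + 1) = p (n + 1) (fun _ => (v.1, 0)) := by
    simp only [hF]; congr 1; ext i <;> simp [i.2]
  rw [← h0, ← h1, ← Finset.sum_range_sub', Finset.sum_range]
  simp only [divSeries, sum_apply, Finset.mul_sum]
  refine Finset.sum_congr rfl fun j _ => ?_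
  set m : Fin (n + 1) → E × ℂ := fun i => if (i : ℕ) < j then (v.1, 0) else v with hm
  have ha : F j = p (n + 1) (Function.update m j v) := by
    simp only [hF]; congr 1; funext i
    by_cases hij : i = j
    · subst hij; simp
    · simp [hij, hm]
  have hb : F (j + 1) = p (n + 1) (Function.update m j (v.1, 0)) := by
    simp only [hF]; congr 1; funext i
    by_cases hij : i = j
    · subst hij; simp
    · have : (i : ℕ) ≠ j := fun h => hij (Fin.ext h)
      have h' : (i : ℕ) < j + 1 ↔ (i : ℕ) < j := by omega
      simp [hij, hm, h']
  rw [ha, hb, ← ContinuousMultilinearMap.map_update_sub]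
  have hc : v - (v.1, 0) = v.2 • ((0 : E), (1 : ℂ)) := by ext <;> simp
  rw [hc, ContinuousMultilinearMap.map_update_smul, smul_eq_mul]
  congr 1
  rw [ContinuousMultilinearMap.compContinuousLinearMap_apply,
    ContinuousMultilinearMap.curryMid_apply]
  congr 1
  funext i
  refine j.succAboveCases ?_ (fun i => ?_) i
  · simp
  · simp only [Fin.insertNth_apply_succAbove, Fin.succAbove_ne, Function.update_of_ne, ne_eq,
      not_false_eq_true, hm]
    by_cases h : i.castSucc < j
    · have : ((j.succAbove i : Fin (n+1)) : ℕ) < j := by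
        rw [Fin.succAbove_of_castSucc_lt _ _ h]; exact h
      simp [h, this]
    · have : ¬ ((j.succAbove i : Fin (n+1)) : ℕ) < j := by
        rw [Fin.succAbove_of_le_castSucc _ _ (not_lt.1 h)]
        have := not_lt.1 h
        rw [Fin.le_def] at this
        simp at this ⊢; omega
      simp [h, this]

/-- A holomorphic function on `E × ℂ` which vanishes on `E × 0` is divisible by the last
coordinate. -/
theorem exists_eq_snd_mul {h : E × ℂ → ℂ} {u : E} (hh : AnalyticAt ℂ h (u, 0))
    (h0 : ∀ᶠ v in 𝓝 u, h (v, 0) = 0) :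
    ∃ a : E × ℂ → ℂ, AnalyticAt ℂ a (u, 0) ∧ ∀ᶠ q in 𝓝 (u, (0 : ℂ)), h q = q.2 * a q := by
  obtain ⟨p, hp⟩ := hh
  have hz : ∀ (n : ℕ) (w : E), p n (fun _ => (w, 0)) = 0 := by
    intro n w
    have hA : HasFPowerSeriesAt (fun w : E => h (w, 0))
        (p.compContinuousLinearMap (ContinuousLinearMap.inl ℂ E ℂ)) u := by
      have := HasFPowerSeriesAt.compContinuousLinearMap (x := u)
        (u := ContinuousLinearMap.inl ℂ E ℂ) (f := h) (pf := p) (by simpa using hp)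
      simpa [Function.comp_def] using this
    have hB : HasFPowerSeriesAt (0 : E → ℂ)
        (p.compContinuousLinearMap (ContinuousLinearMap.inl ℂ E ℂ)) u := hA.congr h0
    have := hB.apply_eq_zero n w
    simpa [FormalMultilinearSeries.compContinuousLinearMap_apply, Function.comp_def] using this
  have hrad := divSeries_radius_pos p hp.radius_pos
  have hq := (divSeries p).hasFPowerSeriesOnBall hrad
  have hq' : HasFPowerSeriesAt (fun w => (divSeries p).sum (w - (u, 0))) (divSeries p) (u, 0) := by
    have := hq.hasFPowerSeriesAt.comp_sub (u, (0 : ℂ))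
    simpa using this
  refine ⟨_, ⟨_, hq'⟩, ?_⟩
  filter_upwards [hp.eventually_hasSum_sub, hq'.eventually_hasSum_sub] with w h1 h2
  have e0 : p 0 (fun _ => w - (u, 0)) = 0 := by
    have := hz 0 0
    rw [← this]; congr 1; funext i; exact i.elim0
  have h3 : HasSum (fun n => p (n + 1) (fun _ => w - (u, 0))) (h w) := by
    have := (hasSum_nat_add_iff' 1).2 h1
    simpa [e0] using this
  have h4 := h2.mul_left w.2
  refine h3.unique ?_
  have hfun : (fun n => p (n + 1) (fun _ => w - (u, 0))) =
      fun n => w.2 * divSeries p n (fun _ => w - (u, 0)) := by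
    funext n
    have := snd_mul_divSeries p n (w - (u, 0))
    simp only [Prod.snd_sub, sub_zero, hz] at this
    exact this.symm
  rw [hfun]
  exact h4
end Division

namespace CplxMan

variable {B S T R : CplxMan.{u}}

/-- `π` is a holomorphic submersion whose fibres have dimension one: around every point it is, in
suitable charts and after a linear isomorphism `B.E × ℂ ≃ S.E`, the projection
`B.E × ℂ → B.E`. -/
abbrev IsRelCurve (π : S ⟶ B) : Prop := IsSubmersionOfComplement ℂ S.I B.I ω π

namespace IsRelCurve

variable {π : S ⟶ B} (hπ : IsRelCurve π) (x : S)

/-- A chart of `S` near `x` in which `π` is the projection to the first factor. -/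
def chart : OpenPartialHomeomorph S (B.E × ℂ) :=
  (hπ x).domChart.transHomeomorph (S.I.toHomeomorph.trans (hπ x).equiv.toHomeomorph)

/-- The chart of `B` near `π x` that goes with `chart`. -/
def baseChart : OpenPartialHomeomorph B B.E :=
  (hπ x).codChart.transHomeomorph B.I.toHomeomorph

theorem mem_chart_source : x ∈ (hπ.chart x).source := (hπ x).mem_domChart_source

theorem mem_baseChart_source {y : S} (hy : y ∈ (hπ.chart x).source) :
    π y ∈ (hπ.baseChart x).source := (hπ x).source_subset_preimage_source hy

theorem chart_fst {y : S} (hy : y ∈ (hπ.chart x).source) :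
    (hπ.chart x y).1 = hπ.baseChart x (π y) := by
  have hy' : y ∈ (hπ x).domChart.source := hy
  have h := (hπ x).writtenInCharts
    (((hπ x).domChart.extend S.I).map_source (by rwa [OpenPartialHomeomorph.extend_source]))
  rw [Function.comp_apply, Function.comp_apply, Function.comp_apply,
    OpenPartialHomeomorph.extend_left_inv _ hy'] at h
  exact h.symm

theorem contMDiffOn_chart :
    ContMDiffOn S.I 𝓘(ℂ, B.E × ℂ) ω (hπ.chart x) (hπ.chart x).source := by
  have h1 := contMDiffOn_of_mem_maximalAtlas (hπ x).domChart_mem_maximalAtlas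
  have h2 : ContMDiff S.I 𝓘(ℂ, S.E) ω S.I := S.I.contMDiff
  have h3 : ContMDiff 𝓘(ℂ, S.E) 𝓘(ℂ, B.E × ℂ) ω (hπ x).equiv :=
    (hπ x).equiv.contDiff.contMDiff
  exact (h3.comp h2).comp_contMDiffOn h1

theorem contMDiffOn_chart_symm :
    ContMDiffOn 𝓘(ℂ, B.E × ℂ) S.I ω (hπ.chart x).symm (hπ.chart x).target := by
  have h1 := contMDiffOn_symm_of_mem_maximalAtlas (hπ x).domChart_mem_maximalAtlas
  have h2 : ContMDiff 𝓘(ℂ, S.E) S.I ω S.I.symm := by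
    rw [← contMDiffOn_univ, ← S.I.range_eq_univ]
    exact S.I.contMDiffOn_symm
  have h3 : ContMDiff 𝓘(ℂ, B.E × ℂ) 𝓘(ℂ, S.E) ω (hπ x).equiv.symm :=
    (hπ x).equiv.symm.contDiff.contMDiff
  exact h1.comp (h2.comp h3).contMDiffOn (fun y hy => hy)

theorem contMDiffOn_baseChart :
    ContMDiffOn B.I 𝓘(ℂ, B.E) ω (hπ.baseChart x) (hπ.baseChart x).source := by
  have h1 := contMDiffOn_of_mem_maximalAtlas (hπ x).codChart_mem_maximalAtlas
  have h2 : ContMDiff B.I 𝓘(ℂ, B.E) ω B.I := B.I.contMDiff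
  exact h2.comp_contMDiffOn h1

end IsRelCurve

/-- The points of the fibre product `T ×_B S`. -/
@[ext]
structure FibreProd (φ : T ⟶ B) (π : S ⟶ B) : Type u where
  fst : T
  snd : S
  eq : φ fst = π snd

namespace FibreProd

variable {π : S ⟶ B} {φ : T ⟶ B}

/-- The inclusion of the fibre product into the product. -/
def toProd (q : FibreProd φ π) : T × S := (q.fst, q.snd)

/-- The fibre product carries the subspace topology. -/
instance : TopologicalSpace (FibreProd φ π) := TopologicalSpace.induced toProd inferInstance

theorem isInducing_toProd : IsInducing (toProd : FibreProd φ π → T × S) := ⟨rfl⟩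

theorem toProd_injective : Function.Injective (toProd : FibreProd φ π → T × S) :=
  fun _ _ h => FibreProd.ext (congrArg Prod.fst h) (congrArg Prod.snd h)

instance : T2Space (FibreProd φ π) :=
  T2Space.of_injective_continuous toProd_injective isInducing_toProd.continuous
instance : SecondCountableTopology (FibreProd φ π) :=
  isInducing_toProd.secondCountableTopology

theorem continuous_fst : Continuous (fst : FibreProd φ π → T) :=
  _root_.continuous_fst.comp isInducing_toProd.continuous
theorem continuous_snd : Continuous (snd : FibreProd φ π → S) :=
  _root_.continuous_snd.comp isInducing_toProd.continuous

variable (hπ : IsRelCurve π) (p : FibreProd φ π)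

/-- The `S`-component of the inverse of `chart`. -/
def chartInv (z : T.H × ℂ) : S :=
  (hπ.chart p.snd).symm (hπ.baseChart p.snd (φ ((chartAt T.H p.fst).symm z.1)), z.2)

/-- The target of `chart`. -/
def chartTarget : Set (T.H × ℂ) :=
  {z | z.1 ∈ (chartAt T.H p.fst).target ∧
    φ ((chartAt T.H p.fst).symm z.1) ∈ (hπ.baseChart p.snd).source ∧
    (hπ.baseChart p.snd (φ ((chartAt T.H p.fst).symm z.1)), z.2) ∈ (hπ.chart p.snd).target}

variable {hπ p} in
theorem chartInv_spec {z : T.H × ℂ} (hz : z ∈ chartTarget hπ p) :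
    φ ((chartAt T.H p.fst).symm z.1) = π (chartInv hπ p z) := by
  obtain ⟨-, h2, h3⟩ := hz
  have h4 := (hπ.chart p.snd).map_target h3
  refine (hπ.baseChart p.snd).injOn h2 (hπ.mem_baseChart_source _ h4) ?_
  have := hπ.chart_fst _ h4
  rw [(hπ.chart p.snd).right_inv h3] at this
  exact this

theorem contMDiffOn_chartInv :
    ContMDiffOn (T.I.prod 𝓘(ℂ, ℂ)) S.I ω (chartInv hπ p) (chartTarget hπ p) := by
  have h1 : ContMDiffOn (T.I.prod 𝓘(ℂ, ℂ)) B.I ω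
      (fun z : T.H × ℂ => φ ((chartAt T.H p.fst).symm z.1)) (chartTarget hπ p) :=
    φ.contMDiff.comp_contMDiffOn
      ((contMDiffOn_chart_symm (I := T.I) (n := ω)).comp contMDiff_fst.contMDiffOn
        (fun z hz => hz.1))
  have h2 := (hπ.contMDiffOn_baseChart p.snd).comp h1 (fun z hz => hz.2.1)
  exact (hπ.contMDiffOn_chart_symm p.snd).comp
    (h2.prodMk_space contMDiff_snd.contMDiffOn) (fun z hz => hz.2.2)

theorem isOpen_chartTarget : IsOpen (chartTarget hπ p) := by
  have h1 : IsOpen (Prod.fst ⁻¹' (chartAt T.H p.fst).target : Set (T.H × ℂ)) :=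
    (chartAt T.H p.fst).open_target.preimage _root_.continuous_fst
  have c1 : ContinuousOn (fun z : T.H × ℂ => φ ((chartAt T.H p.fst).symm z.1))
      (Prod.fst ⁻¹' (chartAt T.H p.fst).target : Set (T.H × ℂ)) :=
    φ.contMDiff.continuous.comp_continuousOn
      ((chartAt T.H p.fst).continuousOn_symm.comp _root_.continuous_fst.continuousOn
        (fun z hz => hz))
  have h2 := c1.isOpen_inter_preimage h1 (hπ.baseChart p.snd).open_source
  have c2 : ContinuousOn (fun z : T.H × ℂ =>
      (hπ.baseChart p.snd (φ ((chartAt T.H p.fst).symm z.1)), z.2)) _ :=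
    ((hπ.baseChart p.snd).continuousOn.comp (c1.mono Set.inter_subset_left)
    (fun z hz => hz.2)).prodMk (_root_.continuous_snd (X := T.H) (Y := ℂ)).continuousOn
  have h3 := c2.isOpen_inter_preimage h2 (hπ.chart p.snd).open_target
  have e : chartTarget hπ p = Prod.fst ⁻¹' (chartAt T.H p.fst).target ∩
      (fun z : T.H × ℂ => φ ((chartAt T.H p.fst).symm z.1)) ⁻¹' (hπ.baseChart p.snd).source ∩
      (fun z : T.H × ℂ => (hπ.baseChart p.snd (φ ((chartAt T.H p.fst).symm z.1)), z.2)) ⁻¹'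
        (hπ.chart p.snd).target := by
    ext z
    exact and_assoc.symm
  rw [e]
  exact h3

variable {hπ p} in
open Classical in
/-- The inverse of `chart`. -/
def chartSymm (hπ : IsRelCurve π) (p : FibreProd φ π) (z : T.H × ℂ) : FibreProd φ π :=
  if hz : φ ((chartAt T.H p.fst).symm z.1) = π (chartInv hπ p z) then
    ⟨(chartAt T.H p.fst).symm z.1, chartInv hπ p z, hz⟩ else p

variable {hπ p} in
theorem chartSymm_fst {z : T.H × ℂ} (hz : z ∈ chartTarget hπ p) :
    (chartSymm hπ p z).fst = (chartAt T.H p.fst).symm z.1 := by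
  rw [chartSymm, dif_pos (chartInv_spec hz)]

variable {hπ p} in
theorem chartSymm_snd {z : T.H × ℂ} (hz : z ∈ chartTarget hπ p) :
    (chartSymm hπ p z).snd = chartInv hπ p z := by
  rw [chartSymm, dif_pos (chartInv_spec hz)]

variable {hπ p} in
theorem map_mem_chartTarget {q : FibreProd φ π} (h1 : q.fst ∈ (chartAt T.H p.fst).source)
    (h2 : q.snd ∈ (hπ.chart p.snd).source) :
    (chartAt T.H p.fst q.fst, (hπ.chart p.snd q.snd).2) ∈ chartTarget hπ p ∧
    chartInv hπ p (chartAt T.H p.fst q.fst, (hπ.chart p.snd q.snd).2) = q.snd := by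
  have e : hπ.baseChart p.snd (φ q.fst) = (hπ.chart p.snd q.snd).1 := by
    rw [hπ.chart_fst _ h2, q.eq]
  simp only [chartTarget, chartInv, Set.mem_ofPred_eq]
  rw [(chartAt T.H p.fst).left_inv h1, e]
  refine ⟨⟨(chartAt T.H p.fst).map_source h1, ?_, (hπ.chart p.snd).map_source h2⟩,
    (hπ.chart p.snd).left_inv h2⟩
  rw [q.eq]
  exact hπ.mem_baseChart_source _ h2

/-- The chart of the fibre product near `p = (b, x)`, made of the chart of `T` at `b` and of a
fibre coordinate of `S` near `x`. -/
def chart : OpenPartialHomeomorph (FibreProd φ π) (ModelProd T.H ℂ) where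
  toFun q := (chartAt T.H p.fst q.fst, (hπ.chart p.snd q.snd).2)
  invFun := chartSymm hπ p
  source := fst ⁻¹' (chartAt T.H p.fst).source ∩ snd ⁻¹' (hπ.chart p.snd).source
  target := chartTarget hπ p
  map_source' := fun q hq => (map_mem_chartTarget hq.1 hq.2).1
  map_target' := by
    intro z hz
    refine ⟨?_, ?_⟩
    · rw [Set.mem_preimage, chartSymm_fst hz]
      exact (chartAt T.H p.fst).map_target hz.1
    · rw [Set.mem_preimage, chartSymm_snd hz]
      exact (hπ.chart p.snd).map_target hz.2.2
  left_inv' := by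
    intro q hq
    have h := map_mem_chartTarget hq.1 hq.2
    refine FibreProd.ext ?_ ?_
    · rw [chartSymm_fst h.1]
      exact (chartAt T.H p.fst).left_inv hq.1
    · rw [chartSymm_snd h.1]
      exact h.2
  right_inv' := by
    intro z hz
    refine Prod.ext ?_ ?_
    · dsimp only
      rw [chartSymm_fst hz]
      exact (chartAt T.H p.fst).right_inv hz.1
    · dsimp only
      rw [chartSymm_snd hz, chartInv, (hπ.chart p.snd).right_inv hz.2.2]
  open_source := ((chartAt T.H p.fst).open_source.preimage continuous_fst).inter
    ((hπ.chart p.snd).open_source.preimage continuous_snd)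
  open_target := isOpen_chartTarget hπ p
  continuousOn_toFun := by
    refine ContinuousOn.prodMk ?_ ?_
    · exact (chartAt T.H p.fst).continuousOn.comp continuous_fst.continuousOn (fun q hq => hq.1)
    · exact _root_.continuous_snd.comp_continuousOn
        ((hπ.chart p.snd).continuousOn.comp continuous_snd.continuousOn (fun q hq => hq.2))
  continuousOn_invFun := by
    have : ContinuousOn (fun z : T.H × ℂ =>
        ((chartAt T.H p.fst).symm z.1, chartInv hπ p z)) (chartTarget hπ p) :=
      ((chartAt T.H p.fst).continuousOn_symm.comp _root_.continuous_fst.continuousOn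
        (fun z hz => hz.1)).prodMk (contMDiffOn_chartInv hπ p).continuousOn
    exact isInducing_toProd.continuousOn_iff.2 (this.congr fun z hz =>
      Prod.ext (chartSymm_fst hz) (chartSymm_snd hz))

/-- The charted space structure of the fibre product. -/
@[reducible]
def charted : ChartedSpace (ModelProd T.H ℂ) (FibreProd φ π) where
  atlas := Set.range (chart hπ)
  chartAt := chart hπ
  mem_chart_source p := ⟨mem_chart_source T.H p.fst, hπ.mem_chart_source p.snd⟩
  chart_mem_atlas p := ⟨p, rfl⟩

theorem contMDiffOn_chartSymm_fst :
    ContMDiffOn (T.I.prod 𝓘(ℂ, ℂ)) T.I ω (fun z : T.H × ℂ => (chartSymm hπ p z).fst)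
      (chartTarget hπ p) :=
  ((contMDiffOn_chart_symm (I := T.I) (n := ω)).comp contMDiff_fst.contMDiffOn
    (fun _ hz => hz.1)).congr fun _ hz => chartSymm_fst hz

theorem contMDiffOn_chartSymm_snd :
    ContMDiffOn (T.I.prod 𝓘(ℂ, ℂ)) S.I ω (fun z : T.H × ℂ => (chartSymm hπ p z).snd)
      (chartTarget hπ p) :=
  (contMDiffOn_chartInv hπ p).congr fun _ hz => chartSymm_snd hz

theorem contMDiffOn_transition (q : FibreProd φ π) :
    ContMDiffOn (T.I.prod 𝓘(ℂ, ℂ)) (T.I.prod 𝓘(ℂ, ℂ)) ω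
      (fun z : T.H × ℂ => (chartAt T.H q.fst (chartSymm hπ p z).fst,
        (hπ.chart q.snd (chartSymm hπ p z).snd).2))
      ((chart hπ p).symm.trans (chart hπ q)).source := by
  refine ContMDiffOn.prodMk ?_ ?_
  · exact (contMDiffOn_chart (I := T.I) (n := ω)).comp
      ((contMDiffOn_chartSymm_fst hπ p).mono fun z hz => hz.1) (fun z hz => hz.2.1)
  · have h : ContMDiff 𝓘(ℂ, B.E × ℂ) 𝓘(ℂ, ℂ) ω (Prod.snd : B.E × ℂ → ℂ) :=
      contDiff_snd.contMDiff
    exact h.comp_contMDiffOn ((hπ.contMDiffOn_chart q.snd).comp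
      ((contMDiffOn_chartSymm_snd hπ p).mono fun z hz => hz.1) (fun z hz => hz.2.2))

theorem isManifold : @IsManifold ℂ _ _ _ _ _ _ (T.I.prod 𝓘(ℂ, ℂ)) ω (FibreProd φ π) _
    (charted hπ) := by
  let := charted (φ := φ) hπ
  refine isManifold_of_contDiffOn _ _ _ ?_
  rintro _ _ ⟨p, rfl⟩ ⟨q, rfl⟩
  have h := contMDiffOn_transition hπ p q
  have hI : ContMDiff 𝓘(ℂ, T.E) T.I ω T.I.symm := by
    rw [← contMDiffOn_univ, ← T.I.range_eq_univ]
    exact T.I.contMDiffOn_symm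
  have h1 : ContMDiff 𝓘(ℂ, T.E × ℂ) (T.I.prod 𝓘(ℂ, ℂ)) ω
      (fun z : T.E × ℂ => (T.I.symm z.1, z.2)) :=
    (hI.comp contDiff_fst.contMDiff).prodMk contDiff_snd.contMDiff
  have h2 : ContMDiff (T.I.prod 𝓘(ℂ, ℂ)) 𝓘(ℂ, T.E × ℂ) ω
      (fun z : T.H × ℂ => (T.I z.1, z.2)) :=
    (T.I.contMDiff.comp contMDiff_fst).prodMk_space contMDiff_snd
  have h3 := (h2.comp_contMDiffOn h).comp h1.contMDiffOn (fun _ hz => hz.1 :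
    (T.I.prod 𝓘(ℂ, ℂ)).symm ⁻¹' ((chart hπ p).symm.trans (chart hπ q)).source ∩
      Set.range (T.I.prod 𝓘(ℂ, ℂ)) ⊆ _)
  exact contMDiffOn_iff_contDiffOn.1 h3

theorem contMDiffOn_chart :
    let := charted (φ := φ) hπ
    ContMDiffOn (T.I.prod 𝓘(ℂ, ℂ)) (M' := T.H × ℂ) (T.I.prod 𝓘(ℂ, ℂ)) ω
      (chart hπ p) (chart hπ p).source := by
  intro
  have := isManifold (φ := φ) hπ
  rw [chartedSpaceSelf_prod]
  exact _root_.contMDiffOn_chart (I := T.I.prod 𝓘(ℂ, ℂ)) (n := ω) (x := p)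

theorem contMDiffOn_chartSymm :
    let := charted (φ := φ) hπ
    ContMDiffOn (M := T.H × ℂ) (T.I.prod 𝓘(ℂ, ℂ)) (T.I.prod 𝓘(ℂ, ℂ)) ω
      (chartSymm hπ p) (chartTarget hπ p) := by
  intro
  have := isManifold (φ := φ) hπ
  rw [chartedSpaceSelf_prod]
  exact _root_.contMDiffOn_chart_symm (I := T.I.prod 𝓘(ℂ, ℂ)) (n := ω) (x := p)

end FibreProd

/-- The fibre product `T ×_B S` of a map `φ : T ⟶ B` with a holomorphic submersion `π : S ⟶ B`
of relative dimension one, as a complex manifold. -/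
def fibreProduct (φ : T ⟶ B) {π : S ⟶ B} (hπ : IsRelCurve π) : CplxMan.{u} :=
  letI := FibreProd.charted (φ := φ) hπ
  haveI := FibreProd.isManifold (φ := φ) hπ
  { carrier := FibreProd φ π
    E := T.E × ℂ
    H := ModelProd T.H ℂ
    I := T.I.prod 𝓘(ℂ, ℂ) }

namespace fibreProduct

variable (φ : T ⟶ B) {π : S ⟶ B} (hπ : IsRelCurve π)

/-- The projection of the fibre product to `T`. -/
def fst : fibreProduct φ hπ ⟶ T :=
  ⟨FibreProd.fst, fun p => by
    let := FibreProd.charted (φ := φ) hπ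
    have h := ((FibreProd.contMDiffOn_chartSymm_fst hπ p).comp (FibreProd.contMDiffOn_chart hπ p)
      (fun q hq => (FibreProd.chart hπ p).map_source hq)).congr
      (f₁ := (FibreProd.fst : FibreProd φ π → T))
      fun q hq => (congrArg FibreProd.fst ((FibreProd.chart hπ p).left_inv hq)).symm
    exact h.contMDiffAt ((FibreProd.chart hπ p).open_source.mem_nhds
      ⟨mem_chart_source T.H p.fst, hπ.mem_chart_source p.snd⟩)⟩

/-- The projection of the fibre product to `S`. -/
def snd : fibreProduct φ hπ ⟶ S :=
  ⟨FibreProd.snd, fun p => by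
    let := FibreProd.charted (φ := φ) hπ
    have h := ((FibreProd.contMDiffOn_chartSymm_snd hπ p).comp (FibreProd.contMDiffOn_chart hπ p)
      (fun q hq => (FibreProd.chart hπ p).map_source hq)).congr
      (f₁ := (FibreProd.snd : FibreProd φ π → S))
      fun q hq => (congrArg FibreProd.snd ((FibreProd.chart hπ p).left_inv hq)).symm
    exact h.contMDiffAt ((FibreProd.chart hπ p).open_source.mem_nhds
      ⟨mem_chart_source T.H p.fst, hπ.mem_chart_source p.snd⟩)⟩

@[simp] theorem fst_apply (q : fibreProduct φ hπ) : fst φ hπ q = FibreProd.fst q := rfl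
@[simp] theorem snd_apply (q : fibreProduct φ hπ) : snd φ hπ q = FibreProd.snd q := rfl

variable {φ}

/-- The map to the fibre product given by two maps that agree over `B`. -/
def lift (f : R ⟶ T) (g : R ⟶ S) (h : f ≫ φ = g ≫ π) : R ⟶ fibreProduct φ hπ :=
  ⟨fun r => (⟨f r, g r, DFunLike.congr_fun h r⟩ : FibreProd φ π), fun r => by
    let := FibreProd.charted (φ := φ) hπ
    set p : FibreProd φ π := ⟨f r, g r, DFunLike.congr_fun h r⟩
    set U : Set R := f ⁻¹' (chartAt T.H (f r)).source ∩ g ⁻¹' (hπ.chart (g r)).source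
    have hU : U ∈ 𝓝 r := Filter.inter_mem
      (f.contMDiff.continuous.continuousAt ((chartAt T.H (f r)).open_source.mem_nhds
        (mem_chart_source T.H (f r))))
      (g.contMDiff.continuous.continuousAt ((hπ.chart (g r)).open_source.mem_nhds
        (hπ.mem_chart_source (g r))))
    have h1 : ContMDiffOn R.I (T.I.prod 𝓘(ℂ, ℂ)) ω
        (fun y : R => (chartAt T.H (f r) (f y), (hπ.chart (g r) (g y)).2)) U := by
      refine ContMDiffOn.prodMk ?_ ?_
      · exact (_root_.contMDiffOn_chart (I := T.I) (n := ω)).comp f.contMDiff.contMDiffOn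
          (fun y hy => hy.1)
      · have h : ContMDiff 𝓘(ℂ, B.E × ℂ) 𝓘(ℂ, ℂ) ω (Prod.snd : B.E × ℂ → ℂ) :=
          contDiff_snd.contMDiff
        exact h.comp_contMDiffOn ((hπ.contMDiffOn_chart (g r)).comp g.contMDiff.contMDiffOn
          (fun y hy => hy.2))
    have h2 := ((FibreProd.contMDiffOn_chartSymm hπ p).comp h1 (fun y hy =>
      (FibreProd.map_mem_chartTarget (hπ := hπ) (p := p)
        (q := ⟨f y, g y, DFunLike.congr_fun h y⟩) hy.1 hy.2).1)).congr
      (f₁ := fun y => (⟨f y, g y, DFunLike.congr_fun h y⟩ : FibreProd φ π)) fun y hy =>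
        ((FibreProd.chart hπ p).left_inv
          (x := ⟨f y, g y, DFunLike.congr_fun h y⟩) hy).symm
    exact h2.contMDiffAt hU⟩

theorem isPullback : IsPullback (fst φ hπ) (snd φ hπ) φ π where
  w := hom_ext fun q => FibreProd.eq q
  isLimit' := ⟨Limits.PullbackCone.IsLimit.mk _
    (fun s => lift hπ s.fst s.snd s.condition) (fun _ => rfl) (fun _ => rfl)
    (fun _ _ h1 h2 => hom_ext fun r => FibreProd.ext
      (DFunLike.congr_fun h1 r) (DFunLike.congr_fun h2 r))⟩

end fibreProduct
end CplxMan

/-- A family of compact Riemann surfaces over `B` with a section: a proper holomorphic submersion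
`proj` with connected fibres of dimension one, and a holomorphic section `sec` of it. -/
structure PointedCurve (B : CplxMan.{u}) where
  total : CplxMan.{u}
  proj : total ⟶ B
  submersion : CplxMan.IsRelCurve proj
  proper : IsProperMap proj
  connected : ∀ b, _root_.IsConnected (proj ⁻¹' {b})
  sec : B ⟶ total
  sec_proj : sec ≫ proj = 𝟙 B

namespace CplxMan
variable {B S T : CplxMan.{u}} (φ : T ⟶ B) {π : S ⟶ B} (hπ : IsRelCurve π)

theorem fibreProduct.submersion_fst : IsRelCurve (fibreProduct.fst φ hπ) := by
  intro p
  have hm : FibreProd.chart hπ p ∈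
      IsManifold.maximalAtlas (fibreProduct φ hπ).I ω (fibreProduct φ hπ) :=
    IsManifold.chart_mem_maximalAtlas (I := (fibreProduct φ hπ).I) p
  refine IsSubmersionAtOfComplement.mk_of_charts (ContinuousLinearEquiv.refl ℂ (T.E × ℂ))
    (FibreProd.chart hπ p) (chartAt T.H (FibreProd.fst p))
    ⟨mem_chart_source T.H _, hπ.mem_chart_source _⟩ (mem_chart_source T.H _) hm
    (IsManifold.chart_mem_maximalAtlas _) (fun q hq => hq.1) ?_
  intro z hz
  have h1 : (FibreProd.chart hπ p).extend (T.I.prod 𝓘(ℂ, ℂ))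
      (((FibreProd.chart hπ p).extend (T.I.prod 𝓘(ℂ, ℂ))).symm z) = z :=
    ((FibreProd.chart hπ p).extend (T.I.prod 𝓘(ℂ, ℂ))).right_inv hz
  exact congrArg Prod.fst h1

theorem fibreProduct.isProperMap_fst (h : IsProperMap π) :
    IsProperMap (fibreProduct.fst φ hπ) := by
  refine isProperMap_iff_ultrafilter.2 ⟨FibreProd.continuous_fst, ?_⟩
  intro (𝒰 : Ultrafilter (FibreProd φ π)) t (ht : Tendsto FibreProd.fst _ _)
  have h1 : Tendsto π ((𝒰.map FibreProd.snd : Ultrafilter S) : Filter S) (𝓝 (φ t)) := by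
    rw [Ultrafilter.coe_map, tendsto_map'_iff]
    exact ((φ.contMDiff.continuous.tendsto t).comp ht).congr fun q => FibreProd.eq q
  obtain ⟨x, hx, hle⟩ := (isProperMap_iff_ultrafilter.1 h).2 h1
  refine ⟨(⟨t, x, hx.symm⟩ : FibreProd φ π), rfl, ?_⟩
  have h2 : Tendsto FibreProd.toProd (𝒰 : Filter (FibreProd φ π)) (𝓝 (t, x)) := by
    rw [nhds_prod_eq]
    exact ht.prodMk hle
  have h3 := FibreProd.isInducing_toProd.nhds_eq_comap (⟨t, x, hx.symm⟩ : FibreProd φ π)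
  exact (map_le_iff_le_comap.1 h2).trans h3.ge

theorem fibreProduct.isConnected_fibre (h : ∀ b, IsConnected (π ⁻¹' {b})) (t : T) :
    IsConnected (fibreProduct.fst φ hπ ⁻¹' {t}) := by
  have := isConnected_iff_connectedSpace.1 (h (φ t))
  let f : π ⁻¹' {φ t} → FibreProd φ π := fun x => ⟨t, x.1, x.2.symm⟩
  have hf : Continuous f := FibreProd.isInducing_toProd.continuous_iff.2
    (continuous_const.prodMk continuous_subtype_val)
  have e : (fibreProduct.fst φ hπ ⁻¹' {t} : Set (FibreProd φ π)) = Set.range f := by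
    ext q
    refine ⟨fun hq => ⟨⟨q.snd, ?_⟩, FibreProd.ext ?_ rfl⟩, ?_⟩
    · exact q.eq.symm.trans (congrArg φ hq)
    · exact (hq : q.fst = t).symm
    · rintro ⟨x, rfl⟩
      rfl
  exact e ▸ isConnected_range hf

end CplxMan

namespace PointedCurve

variable {B T : CplxMan.{u}} (C : PointedCurve B)

theorem proj_sec (b : B) : C.proj (C.sec b) = b := DFunLike.congr_fun C.sec_proj b

/-- The base change of a family along `φ`. -/
def pullback (φ : T ⟶ B) : PointedCurve T where
  total := CplxMan.fibreProduct φ C.submersion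
  proj := CplxMan.fibreProduct.fst φ C.submersion
  submersion := CplxMan.fibreProduct.submersion_fst φ C.submersion
  proper := CplxMan.fibreProduct.isProperMap_fst φ C.submersion C.proper
  connected := CplxMan.fibreProduct.isConnected_fibre φ C.submersion C.connected
  sec := CplxMan.fibreProduct.lift C.submersion (𝟙 T) (φ ≫ C.sec) (by
    rw [Category.id_comp, Category.assoc, C.sec_proj, Category.comp_id])
  sec_proj := rfl

end PointedCurve

/-- Germs of functions along a filter form a complex algebra. -/
instance germAlgebra {α : Type*} (l : Filter α) : Algebra ℂ (l.Germ ℂ) :=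
  Algebra.ofModule
    (fun c a b => Quotient.inductionOn₂' a b fun f g =>
      congrArg (Germ.ofFun (l := l)) (smul_mul_assoc c f g))
    (fun c a b => Quotient.inductionOn₂' a b fun f g =>
      congrArg (Germ.ofFun (l := l)) (mul_smul_comm c f g))

section Tails

variable (X : CplxMan.{u}) (D : Set X) (k : ℕ)

/-- Germs at `x` of functions on the complement of `D`. -/
abbrev PunctGerm (x : X) : Type u := (𝓝[Dᶜ] x).Germ ℂ

/-- The stalk `𝒪_x` of the sheaf of holomorphic functions, inside the germs of functions on the
complement of `D`. -/
def holGerm (x : X) : Subalgebra ℂ (PunctGerm X D x) where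
  carrier := {a | ∃ f : X → ℂ, ContMDiffAt X.I 𝓘(ℂ) ω f x ∧ (f : PunctGerm X D x) = a}
  mul_mem' := by
    rintro _ _ ⟨f, hf, rfl⟩ ⟨g, hg, rfl⟩
    exact ⟨f * g, hf.mul hg, rfl⟩
  add_mem' := by
    rintro _ _ ⟨f, hf, rfl⟩ ⟨g, hg, rfl⟩
    exact ⟨f + g, hf.add hg, rfl⟩
  algebraMap_mem' := fun c => ⟨fun _ => c, contMDiffAt_const, by
    rw [Algebra.algebraMap_eq_smul_one]
    refine congrArg _ (funext fun _ => ?_)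
    simp⟩

/-- The stalk `ℐ_x` of the ideal sheaf of holomorphic functions vanishing on `D`. -/
def idealGerm (x : X) : Ideal (holGerm X D x) where
  carrier := {a | ∃ f : X → ℂ, ContMDiffAt X.I 𝓘(ℂ) ω f x ∧ (∀ᶠ y in 𝓝[D] x, f y = 0) ∧
    (f : PunctGerm X D x) = a}
  add_mem' := by
    rintro ⟨_, _⟩ ⟨_, _⟩ ⟨f, hf, h, rfl⟩ ⟨g, hg, h', rfl⟩
    refine ⟨f + g, hf.add hg, ?_, rfl⟩
    filter_upwards [h, h'] with y h1 h2
    simp [h1, h2]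
  zero_mem' := ⟨0, contMDiffAt_const, Eventually.of_forall fun _ => rfl, rfl⟩
  smul_mem' := by
    rintro ⟨_, ⟨f, hf, rfl⟩⟩ ⟨_, _⟩ ⟨g, hg, h, rfl⟩
    refine ⟨f * g, hf.mul hg, ?_, rfl⟩
    filter_upwards [h] with y h1
    simp [h1]

/-- The stalk at `x` of `𝒪(kD)`, the inverse of the ideal sheaf `ℐ ^ k`: germs of functions on the
complement of `D` whose product with every element of `ℐ_x ^ k` is holomorphic at `x`. If `D` has
a local equation `z` at `x`, these are the germs `a / z ^ k` with `a` holomorphic. -/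
def poleGerm (x : X) : Submodule ℂ (PunctGerm X D x) where
  carrier := {m | ∀ h ∈ idealGerm X D x ^ k, (h : PunctGerm X D x) * m ∈ holGerm X D x}
  add_mem' := fun hm hn h hh => by rw [mul_add]; exact add_mem (hm h hh) (hn h hh)
  zero_mem' := fun h _ => by rw [mul_zero]; exact zero_mem _
  smul_mem' := fun c m hm h hh => by
    rw [mul_smul_comm]; exact Subalgebra.smul_mem _ (hm h hh) c

/-- The stalk at `x` of the sheaf of tails `𝒪(kD) / 𝒪`. -/
abbrev TailStalk (x : X) : Type u :=
  poleGerm X D k x ⧸ (Subalgebra.toSubmodule (holGerm X D x)).submoduleOf (poleGerm X D k x)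

/-- Sections of `𝒪(kD)` over an open set `U`: functions on the complement of `D` in `U` with germs
in the stalks of `𝒪(kD)` (values outside `U` and on `D` are irrelevant). -/
def poleSections (U : Set X) : Submodule ℂ (X → ℂ) where
  carrier := {f | ∀ x ∈ U, (f : PunctGerm X D x) ∈ poleGerm X D k x}
  add_mem' := fun hf hg x hx => (poleGerm X D k x).add_mem (hf x hx) (hg x hx)
  zero_mem' := fun x _ => (poleGerm X D k x).zero_mem
  smul_mem' := fun c _ hf x hx => (poleGerm X D k x).smul_mem c (hf x hx)

variable {X} in
/-- The tail at a point `x` of `U` of a section of `𝒪(kD)` over `U`. -/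
def tailAt {U : Set X} {x : X} (hx : x ∈ U) : poleSections X D k U →ₗ[ℂ] TailStalk X D k x :=
  (Submodule.mkQ _).comp
    ({ toFun := fun f => ⟨(f.1 : PunctGerm X D x), f.2 x hx⟩
       map_add' := fun _ _ => rfl
       map_smul' := fun _ _ => rfl } : poleSections X D k U →ₗ[ℂ] poleGerm X D k x)

/-- Restriction of sections of `𝒪(kD)`. -/
def resSections {U V : Set X} (h : V ⊆ U) : poleSections X D k U →ₗ[ℂ] poleSections X D k V :=
  Submodule.inclusion fun _ hf x hx => hf x (h hx)

variable (t : Type v) [AddCommGroup t] [Module ℂ t]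

/-- The global sections of the sheaf `t ⊗ (𝒪(kD) / 𝒪)`, described as the sheaf associated to the
presheaf `U ↦ t ⊗ (Γ(U, 𝒪(kD)) / Γ(U, 𝒪))`: families of elements of the stalks which are locally
induced by elements of `t ⊗ Γ(U, 𝒪(kD))`. -/
def tailSections : Submodule ℂ (∀ x : X, t ⊗[ℂ] TailStalk X D k x) where
  carrier := {s | ∀ x, ∃ U : Set X, IsOpen U ∧ x ∈ U ∧ ∃ p : t ⊗[ℂ] poleSections X D k U,
    ∀ (y : X) (hy : y ∈ U), s y = (tailAt D k hy).lTensor t p}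
  add_mem' := by
    intro s s' hs hs' x
    obtain ⟨U, hU, hx, p, hp⟩ := hs x
    obtain ⟨V, hV, hx', q, hq⟩ := hs' x
    refine ⟨U ∩ V, hU.inter hV, ⟨hx, hx'⟩,
      (resSections X D k Set.inter_subset_left).lTensor t p +
        (resSections X D k Set.inter_subset_right).lTensor t q, fun y hy => ?_⟩
    rw [map_add, ← LinearMap.lTensor_comp_apply, ← LinearMap.lTensor_comp_apply]
    exact congrArg₂ (· + ·) (hp y hy.1) (hq y hy.2)
  zero_mem' := fun x => ⟨Set.univ, isOpen_univ, trivial, 0, fun y hy => by simp⟩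
  smul_mem' := by
    intro c s hs x
    obtain ⟨U, hU, hx, p, hp⟩ := hs x
    exact ⟨U, hU, hx, c • p, fun y hy => by rw [map_smul, ← hp y hy]; rfl⟩

end Tails

section Pullback

variable {X Y : CplxMan.{u}} {D : Set X} {D' : Set Y}

theorem tendsto_punct (ψ : Y ⟶ X) (hD : ψ ⁻¹' D = D') (y : Y) :
    Tendsto ψ (𝓝[D'ᶜ] y) (𝓝[Dᶜ] (ψ y)) :=
  ψ.contMDiff.continuous.continuousWithinAt.tendsto_nhdsWithin fun _ hz h => hz (hD ▸ h)

/-- Pullback of germs of functions along a holomorphic map. -/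
def pullGerm (ψ : Y ⟶ X) (hD : ψ ⁻¹' D = D') (y : Y) :
    PunctGerm X D (ψ y) →ₐ[ℂ] PunctGerm Y D' y where
  toFun a := a.compTendsto ψ (tendsto_punct ψ hD y)
  map_one' := rfl
  map_mul' a b := Quotient.inductionOn₂' a b fun _ _ => rfl
  map_zero' := rfl
  map_add' a b := Quotient.inductionOn₂' a b fun _ _ => rfl
  commutes' c := by
    rw [Algebra.algebraMap_eq_smul_one, Algebra.algebraMap_eq_smul_one]
    rfl

variable (ψ : Y ⟶ X) (hD : ψ ⁻¹' D = D') (y : Y)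

theorem pullGerm_coe (f : X → ℂ) :
    pullGerm ψ hD y (f : PunctGerm X D (ψ y)) = ((f ∘ ψ : Y → ℂ) : PunctGerm Y D' y) := rfl

theorem pullGerm_mem {a : PunctGerm X D (ψ y)} (ha : a ∈ holGerm X D (ψ y)) :
    pullGerm ψ hD y a ∈ holGerm Y D' y := by
  obtain ⟨f, hf, rfl⟩ := ha
  exact ⟨f ∘ ψ, hf.comp y (ψ.contMDiff y), rfl⟩

/-- Pullback of germs of holomorphic functions. -/
def pullHol : holGerm X D (ψ y) →ₐ[ℂ] holGerm Y D' y :=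
  ((pullGerm ψ hD y).comp (holGerm X D (ψ y)).val).codRestrict _ fun a => pullGerm_mem ψ hD y a.2

/-- `ψ` pulls back the ideal sheaf of `D` to that of the preimage of `D`: the latter is generated by
the pullbacks of functions that vanish on `D`. -/
structure PullsBack (ψ : Y ⟶ X) (D : Set X) (D' : Set Y) : Prop where
  preimage : ψ ⁻¹' D = D'
  ideal_le : ∀ y, idealGerm Y D' y ≤ (idealGerm X D (ψ y)).map (pullHol ψ preimage y)

theorem map_idealGerm_le :
    (idealGerm X D (ψ y)).map (pullHol ψ hD y) ≤ idealGerm Y D' y := by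
  rw [Ideal.map_le_iff_le_comap]
  rintro ⟨_, _⟩ ⟨f, hf, h, rfl⟩
  refine ⟨f ∘ ψ, hf.comp y (ψ.contMDiff y), ?_, rfl⟩
  have : Tendsto ψ (𝓝[D'] y) (𝓝[D] (ψ y)) :=
    ψ.contMDiff.continuous.continuousWithinAt.tendsto_nhdsWithin fun _ hz => hD.symm.subset hz
  exact this.eventually h

theorem pullGerm_comp {Z : CplxMan.{u}} {D'' : Set Z} (χ : Z ⟶ Y) (h₁ : χ ⁻¹' D' = D'')
    (h₂ : ψ ⁻¹' D = D') (h : (χ ≫ ψ) ⁻¹' D = D'') (z : Z) (a : PunctGerm X D (ψ (χ z))) :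
    pullGerm (χ ≫ ψ) h z a = pullGerm χ h₁ z (pullGerm ψ h₂ (χ z) a) :=
  Quotient.inductionOn' a fun _ => rfl

theorem pullGerm_id (x : X) (a : PunctGerm X D x) : pullGerm (𝟙 X) rfl x a = a :=
  Quotient.inductionOn' a fun _ => rfl

theorem PullsBack.of_comp {Z : CplxMan.{u}} {D'' : Set Z} (χ : Z ⟶ Y)
    (h₁ : χ ⁻¹' D' = D'') (h₂ : ψ ⁻¹' D = D') (h : PullsBack (χ ≫ ψ) D D'') :
    PullsBack χ D' D'' := by
  refine ⟨h₁, fun z => (h.ideal_le z).trans ?_⟩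
  refine Ideal.map_le_iff_le_comap.2 fun a ha => ?_
  have e : pullHol (χ ≫ ψ) h.preimage z a = pullHol χ h₁ z (pullHol ψ h₂ (χ z) a) :=
    Subtype.ext (pullGerm_comp ψ χ h₁ h₂ h.preimage z a.1)
  rw [Ideal.mem_comap, e]
  exact Ideal.mem_map_of_mem _ (map_idealGerm_le ψ h₂ (χ z) (Ideal.mem_map_of_mem _ ha))

variable {ψ} (k : ℕ)

theorem PullsBack.pullGerm_mem_poleGerm (h : PullsBack ψ D D') {m : PunctGerm X D (ψ y)}
    (hm : m ∈ poleGerm X D k (ψ y)) : pullGerm ψ h.preimage y m ∈ poleGerm Y D' k y := by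
  intro b hb
  have hb' := Ideal.pow_right_mono (h.ideal_le y) k hb
  rw [← Ideal.map_pow] at hb'
  refine Submodule.span_induction (p := fun (b : holGerm Y D' y) _ => (b : PunctGerm Y D' y) *
    pullGerm ψ h.preimage y m ∈ holGerm Y D' y) ?_ ?_ ?_ ?_ hb'
  · rintro _ ⟨a, ha, rfl⟩
    have := pullGerm_mem ψ h.preimage y (hm a ha)
    rwa [map_mul] at this
  · rw [ZeroMemClass.coe_zero, zero_mul]
    exact zero_mem _
  · intro a b _ _ ha hb
    rw [AddMemClass.coe_add, add_mul]
    exact add_mem ha hb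
  · intro c a _ ha
    rw [smul_eq_mul, MulMemClass.coe_mul, mul_assoc]
    exact mul_mem c.2 ha

/-- Pullback of germs of functions with poles of order at most `k`. -/
def pullPole (h : PullsBack ψ D D') : poleGerm X D k (ψ y) →ₗ[ℂ] poleGerm Y D' k y :=
  (pullGerm ψ h.preimage y).toLinearMap.restrict fun _ hm => h.pullGerm_mem_poleGerm y k hm

/-- Pullback of tails at a point. -/
def pullStalk (h : PullsBack ψ D D') : TailStalk X D k (ψ y) →ₗ[ℂ] TailStalk Y D' k y :=
  Submodule.mapQ _ _ (pullPole y k h) fun _ hm => pullGerm_mem ψ h.preimage y hm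

/-- Pullback of sections of `𝒪(kD)`. -/
def pullSections (h : PullsBack ψ D D') (U : Set X) :
    poleSections X D k U →ₗ[ℂ] poleSections Y D' k (ψ ⁻¹' U) where
  toFun f := ⟨f.1 ∘ ψ, fun y hy => h.pullGerm_mem_poleGerm y k (f.2 (ψ y) hy)⟩
  map_add' _ _ := rfl
  map_smul' _ _ := rfl

variable (t : Type v) [AddCommGroup t] [Module ℂ t]

/-- Pullback of global sections of `t ⊗ (𝒪(kD) / 𝒪)`. -/
def pullTails (h : PullsBack ψ D D') : tailSections X D k t →ₗ[ℂ] tailSections Y D' k t where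
  toFun s := ⟨fun y => (pullStalk y k h).lTensor t (s.1 (ψ y)), fun y => by
    obtain ⟨U, hU, hy, p, hp⟩ := s.2 (ψ y)
    refine ⟨ψ ⁻¹' U, hU.preimage ψ.contMDiff.continuous, hy,
      (pullSections k h U).lTensor t p, fun z hz => ?_⟩
    dsimp only
    rw [hp (ψ z) hz, ← LinearMap.lTensor_comp_apply, ← LinearMap.lTensor_comp_apply]
    rfl⟩
  map_add' s s' := Subtype.ext (funext fun y =>
    ((pullStalk y k h).lTensor t).map_add (s.1 (ψ y)) (s'.1 (ψ y)))
  map_smul' c s := Subtype.ext (funext fun y =>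
    ((pullStalk y k h).lTensor t).map_smul c (s.1 (ψ y)))

theorem pullTails_id (h : PullsBack (𝟙 X) D D) (s : tailSections X D k t) :
    pullTails k t h s = s := by
  refine Subtype.ext (funext fun y => ?_)
  let L : TailStalk X D k y →ₗ[ℂ] TailStalk X D k y := pullStalk (ψ := 𝟙 X) y k h
  have e : L = LinearMap.id :=
    Submodule.linearMap_qext _ (LinearMap.ext fun m =>
      congrArg (Submodule.mkQ _) (Subtype.ext (pullGerm_id y m.1)))
  change L.lTensor t (s.1 y) = s.1 y
  rw [e, LinearMap.lTensor_id, LinearMap.id_apply]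

theorem pullTails_comp {Z : CplxMan.{u}} {D'' : Set Z} {χ : Z ⟶ Y} (h₁ : PullsBack χ D' D'')
    (h₂ : PullsBack ψ D D') (h : PullsBack (χ ≫ ψ) D D'') (s : tailSections X D k t) :
    pullTails k t h s = pullTails k t h₁ (pullTails k t h₂ s) := by
  refine Subtype.ext (funext fun z => ?_)
  let L : TailStalk X D k (ψ (χ z)) →ₗ[ℂ] TailStalk Z D'' k z :=
    pullStalk (ψ := χ ≫ ψ) z k h
  have e : L = (pullStalk z k h₁).comp (pullStalk (χ z) k h₂) :=
    Submodule.linearMap_qext _ (LinearMap.ext fun m => congrArg (Submodule.mkQ _)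
      (Subtype.ext (pullGerm_comp ψ χ h₁.preimage h₂.preimage h.preimage z m.1)))
  change L.lTensor t (s.1 (ψ (χ z))) =
    (pullStalk z k h₁).lTensor t ((pullStalk (χ z) k h₂).lTensor t (s.1 (ψ (χ z))))
  rw [e, LinearMap.lTensor_comp_apply]

end Pullback

namespace PointedCurve

variable {B T T' : CplxMan.{u}} (C : PointedCurve B)

/-- The image of the section. -/
def divisor : Set C.total := Set.range C.sec

theorem isClosed_divisor : IsClosed C.divisor := by
  have e : C.divisor = {x | C.sec (C.proj x) = x} := by
    ext x
    refine ⟨?_, fun h => ⟨_, h⟩⟩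
    rintro ⟨b, rfl⟩
    exact congrArg C.sec (C.proj_sec b)
  rw [e]
  exact isClosed_eq (C.sec.contMDiff.continuous.comp C.proj.contMDiff.continuous) continuous_id

variable (φ : T ⟶ B)

/-- The map from the base change of `C` to the total space of `C`. -/
def toTotal : (C.pullback φ).total ⟶ C.total := CplxMan.fibreProduct.snd φ C.submersion

theorem preimage_divisor : C.toTotal φ ⁻¹' C.divisor = (C.pullback φ).divisor := by
  ext (q : CplxMan.FibreProd φ C.proj)
  constructor
  · rintro ⟨b, hb⟩
    have hb' : C.sec b = q.snd := hb
    have h1 : φ q.fst = b := by rw [q.eq, ← hb', C.proj_sec]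
    exact ⟨q.fst, CplxMan.FibreProd.ext rfl (by rw [← hb', ← h1]; rfl)⟩
  · rintro ⟨t, rfl⟩
    exact ⟨φ t, rfl⟩

theorem pullsBack_toTotal : PullsBack (C.toTotal φ) C.divisor (C.pullback φ).divisor := by
  refine ⟨C.preimage_divisor φ, fun (p : CplxMan.FibreProd φ C.proj) => ?_⟩
  let hπ := C.submersion
  by_cases hp : (p : (C.pullback φ).total) ∈ (C.pullback φ).divisor
  swap
  · have h1 : (1 : holGerm C.total C.divisor p.snd) ∈ idealGerm C.total C.divisor p.snd := by
      refine ⟨fun _ => 1, contMDiffAt_const, ?_, rfl⟩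
      have h2 : p.snd ∈ C.divisorᶜ := fun h => hp ((C.preimage_divisor φ).subset h)
      have h3 : 𝓝[C.divisor] p.snd = ⊥ := by
        rw [← not_neBot, ← mem_closure_iff_nhdsWithin_neBot, C.isClosed_divisor.closure_eq]
        exact h2
      rw [h3]; exact eventually_bot
    have h4 := Ideal.mem_map_of_mem (pullHol (C.toTotal φ) (C.preimage_divisor φ) p) h1
    have h5 : pullHol (C.toTotal φ) (C.preimage_divisor φ) p
        (1 : holGerm C.total C.divisor p.snd) = 1 :=
      (pullHol (C.toTotal φ) (C.preimage_divisor φ) p).map_one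
    rw [h5] at h4
    exact le_top.trans ((Ideal.eq_top_iff_one _).2 h4).ge
  obtain ⟨t₀, ht₀⟩ := hp
  rintro ⟨_, _⟩ ⟨f, hf, hf0, rfl⟩
  let := CplxMan.FibreProd.charted (φ := φ) hπ
  -- the tautological section and the fibre coordinate
  let σ : T → CplxMan.FibreProd φ C.proj := fun t => ⟨t, C.sec (φ t), (C.proj_sec _).symm⟩
  have hσ : Continuous σ := (C.pullback φ).sec.contMDiff.continuous
  have hpσ : p = σ p.fst := by rw [← ht₀]; rfl
  let K := hπ.chart p.snd
  let χ := chartAt T.H p.fst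
  let z : C.total → ℂ := fun x => (K x).2 - (K (C.sec (C.proj x))).2
  have hps : C.sec (C.proj p.snd) = p.snd := by
    rw [hpσ]; exact congrArg C.sec (C.proj_sec _)
  have hsnd : ContMDiff 𝓘(ℂ, B.E × ℂ) 𝓘(ℂ, ℂ) ω (Prod.snd : B.E × ℂ → ℂ) :=
    contDiff_snd.contMDiff
  have hK : ∀ x ∈ K.source, ContMDiffAt C.total.I 𝓘(ℂ) ω (fun x => (K x).2) x := fun x hx =>
    (hsnd.comp_contMDiffOn (hπ.contMDiffOn_chart p.snd)).contMDiffAt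
      (K.open_source.mem_nhds hx)
  have hKp : p.snd ∈ K.source := hπ.mem_chart_source p.snd
  have hz : ContMDiffAt C.total.I 𝓘(ℂ) ω z p.snd := by
    refine (hK _ hKp).sub ?_
    have h1 : ContMDiffAt C.total.I C.total.I ω (fun x => C.sec (C.proj x)) p.snd :=
      (C.sec.contMDiff.comp C.proj.contMDiff) p.snd
    exact ContMDiffAt.comp (g := fun x => (K x).2) p.snd (by rw [hps]; exact hK _ hKp) h1
  have hzI : (⟨(z : PunctGerm C.total C.divisor p.snd), ⟨z, hz, rfl⟩⟩ :
      holGerm C.total C.divisor p.snd) ∈ idealGerm C.total C.divisor p.snd := by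
    refine ⟨z, hz, ?_, rfl⟩
    refine eventually_nhdsWithin_of_forall ?_
    rintro _ ⟨b, rfl⟩
    change (K (C.sec b)).2 - (K (C.sec (C.proj (C.sec b)))).2 = 0
    rw [C.proj_sec, sub_self]
  -- coordinates on the fibre product
  have hI : ContMDiff 𝓘(ℂ, T.E) T.I ω T.I.symm := by
    rw [← contMDiffOn_univ, ← T.I.range_eq_univ]
    exact T.I.contMDiffOn_symm
  let τ : T.E → T := fun v => χ.symm (T.I.symm v)
  let s : T.E → ℂ := fun v => (K (C.sec (φ (τ v)))).2
  let v₀ : T.E := T.I (χ p.fst)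
  have hv₀ : T.I.symm v₀ = χ p.fst := T.I.left_inv _
  have hτ₀ : τ v₀ = p.fst := by
    change χ.symm (T.I.symm v₀) = _
    rw [hv₀, χ.left_inv (mem_chart_source T.H p.fst)]
  have hτ : ContMDiffAt 𝓘(ℂ, T.E) T.I ω τ v₀ := by
    refine ContMDiffAt.comp v₀ (g := χ.symm) ?_ (hI v₀)
    rw [hv₀]
    exact (contMDiffOn_chart_symm (I := T.I) (n := ω)).contMDiffAt
      (χ.open_target.mem_nhds (χ.map_source (mem_chart_source T.H p.fst)))
  have hsp : C.sec (φ p.fst) = p.snd := by rw [p.eq, hps]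
  have hs : ContMDiffAt 𝓘(ℂ, T.E) 𝓘(ℂ) ω s v₀ := by
    have h1 : ContMDiffAt 𝓘(ℂ, T.E) C.total.I ω (fun v => C.sec (φ (τ v))) v₀ :=
      (C.sec.contMDiff.comp φ.contMDiff).contMDiffAt.comp v₀ hτ
    exact ContMDiffAt.comp (g := fun x => (K x).2) v₀
      (by rw [hτ₀, hsp]; exact hK _ hKp) h1
  let G₀ : T.E × ℂ → T.H × ℂ := fun w => (T.I.symm w.1, w.2 + s w.1)
  have hG₀ : ContMDiffAt 𝓘(ℂ, T.E × ℂ) (T.I.prod 𝓘(ℂ, ℂ)) ω G₀ (v₀, 0) := by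
    have h1 : ContMDiffAt 𝓘(ℂ, T.E × ℂ) 𝓘(ℂ, T.E) ω (Prod.fst : T.E × ℂ → T.E) (v₀, 0) :=
      contDiff_fst.contMDiff.contMDiffAt
    have h2 : ContMDiffAt 𝓘(ℂ, T.E × ℂ) 𝓘(ℂ, ℂ) ω (Prod.snd : T.E × ℂ → ℂ) (v₀, 0) :=
      contDiff_snd.contMDiff.contMDiffAt
    exact ((hI.contMDiffAt).comp _ h1).prodMk (h2.add (ContMDiffAt.comp _ (g := s) hs h1))
  have hmem := CplxMan.FibreProd.map_mem_chartTarget (hπ := hπ) (p := p) (q := p)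
    (mem_chart_source T.H p.fst) hKp
  have hG₀p : G₀ (v₀, 0) = (χ p.fst, (K p.snd).2) := by
    refine Prod.ext hv₀ ?_
    change 0 + (K (C.sec (φ (τ v₀)))).2 = _
    rw [hτ₀, hsp, zero_add]
  let G : T.E × ℂ → CplxMan.FibreProd φ C.proj :=
    fun w => CplxMan.FibreProd.chartSymm hπ p (G₀ w)
  have hGp : G (v₀, 0) = p := by
    change CplxMan.FibreProd.chartSymm hπ p (G₀ (v₀, 0)) = p
    rw [hG₀p]
    exact (CplxMan.FibreProd.chart hπ p).left_inv ⟨mem_chart_source T.H p.fst, hKp⟩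
  have hG : ContMDiffAt 𝓘(ℂ, T.E × ℂ) (T.I.prod 𝓘(ℂ, ℂ)) ω G (v₀, 0) := by
    refine ContMDiffAt.comp _ (g := CplxMan.FibreProd.chartSymm hπ p) ?_ hG₀
    rw [hG₀p]
    exact (CplxMan.FibreProd.contMDiffOn_chartSymm hπ p).contMDiffAt
      ((CplxMan.FibreProd.isOpen_chartTarget hπ p).mem_nhds hmem.1)
  let f' : CplxMan.FibreProd φ C.proj → ℂ := f
  have hf' : ContMDiffAt (T.I.prod 𝓘(ℂ, ℂ)) 𝓘(ℂ) ω f' p := hf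
  have hfG : AnalyticAt ℂ (f' ∘ G) (v₀, 0) := by
    have h1 : ContMDiffAt 𝓘(ℂ, T.E × ℂ) 𝓘(ℂ) ω (f' ∘ G) (v₀, 0) := by
      refine ContMDiffAt.comp _ ?_ hG
      rw [hGp]
      exact hf'
    exact (contMDiffAt_iff_contDiffAt.1 h1).analyticAt
  have hfG0 : ∀ᶠ v in 𝓝 v₀, (f' ∘ G) (v, 0) = 0 := by
    have h1 : ∀ᶠ v in 𝓝 v₀, T.I.symm v ∈ χ.target :=
      (hI v₀).continuousAt.eventually_mem (χ.open_target.mem_nhds (by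
        rw [hv₀]; exact χ.map_source (mem_chart_source T.H p.fst)))
    have hσsnd : ContinuousAt (fun v => C.sec (φ (τ v))) v₀ :=
      (C.sec.contMDiff.continuous.comp φ.contMDiff.continuous).continuousAt.comp
        hτ.continuousAt
    have h2 : ∀ᶠ v in 𝓝 v₀, C.sec (φ (τ v)) ∈ K.source :=
      hσsnd.eventually_mem (K.open_source.mem_nhds (by rw [hτ₀, hsp]; exact hKp))
    have h3 : ∀ᶠ v in 𝓝 v₀, f (σ (τ v)) = 0 := by
      have h4 : Tendsto (fun v => σ (τ v)) (𝓝 v₀)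
          (𝓝[(C.pullback φ).divisor] (p : (C.pullback φ).total)) := by
        refine tendsto_nhdsWithin_iff.2 ⟨?_, Eventually.of_forall fun v => ⟨τ v, rfl⟩⟩
        have h5 : ContinuousAt (fun v => σ (τ v)) v₀ :=
          hσ.continuousAt.comp hτ.continuousAt
        have h6 : σ (τ v₀) = p := by rw [hτ₀, ← hpσ]
        exact h6 ▸ h5
      exact h4.eventually hf0
    filter_upwards [h1, h2, h3] with v hv1 hv2 hv3
    have e1 : χ (τ v) = T.I.symm v := χ.right_inv hv1
    have e2 : G (v, 0) = σ (τ v) := by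
      have h := (CplxMan.FibreProd.chart hπ p).left_inv (x := σ (τ v))
        ⟨χ.map_target hv1, hv2⟩
      rw [← h]
      change CplxMan.FibreProd.chartSymm hπ p (T.I.symm v, 0 + s v) =
        CplxMan.FibreProd.chartSymm hπ p (χ (τ v), s v)
      rw [e1, zero_add]
    change f (G (v, 0)) = 0
    rw [e2, hv3]
  obtain ⟨a, ha, hfa⟩ := exists_eq_snd_mul hfG hfG0
  let w : CplxMan.FibreProd φ C.proj → T.E × ℂ := fun q => (T.I (χ q.fst), z q.snd)
  have hwp : w p = (v₀, 0) := by
    refine Prod.ext rfl ?_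
    change (K p.snd).2 - (K (C.sec (C.proj p.snd))).2 = 0
    rw [hps, sub_self]
  have hw : ContMDiffAt (T.I.prod 𝓘(ℂ, ℂ)) 𝓘(ℂ, T.E × ℂ) ω w p := by
    refine ContMDiffAt.prodMk_space ?_ ?_
    · have h1 : ContMDiffAt T.I T.I ω χ p.fst :=
        (contMDiffOn_chart (I := T.I) (n := ω)).contMDiffAt
          (χ.open_source.mem_nhds (mem_chart_source T.H p.fst))
      exact (T.I.contMDiff.contMDiffAt.comp _ h1).comp p
        ((CplxMan.fibreProduct.fst φ hπ).contMDiff p)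
    · exact ContMDiffAt.comp p hz ((CplxMan.fibreProduct.snd φ hπ).contMDiff p)
  have haw : ContMDiffAt (T.I.prod 𝓘(ℂ, ℂ)) 𝓘(ℂ) ω (a ∘ w) p := by
    refine ContMDiffAt.comp p ?_ hw
    rw [hwp]
    exact ha.contDiffAt.contMDiffAt
  have key : ∀ᶠ q in 𝓝 p, f q = z q.snd * a (w q) := by
    have h1 := hw.continuousAt.eventually (hwp.symm ▸ hfa)
    filter_upwards [h1, (CplxMan.FibreProd.chart hπ p).open_source.mem_nhds
      ⟨mem_chart_source T.H p.fst, hKp⟩] with q hq1 hq2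
    have h2 : G (w q) = q := by
      have h := (CplxMan.FibreProd.chart hπ p).left_inv hq2
      refine Eq.trans ?_ h
      change CplxMan.FibreProd.chartSymm hπ p _ = CplxMan.FibreProd.chartSymm hπ p _
      congr 1
      refine Prod.ext (T.I.left_inv _) ?_
      change z q.snd + (K (C.sec (φ (χ.symm (T.I.symm (T.I (χ q.fst))))))).2 = (K q.snd).2
      rw [T.I.left_inv, χ.left_inv hq2.1, q.eq]
      exact sub_add_cancel _ _
    have h3 : f (G (w q)) = (w q).2 * a (w q) := hq1
    rw [h2] at h3
    exact h3
  have e : (⟨(f : PunctGerm (C.pullback φ).total (C.pullback φ).divisor p), ⟨f, hf, rfl⟩⟩ :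
      holGerm _ (C.pullback φ).divisor p) =
      ⟨((a ∘ w : (C.pullback φ).total → ℂ) : PunctGerm _ (C.pullback φ).divisor p),
        ⟨a ∘ w, haw, rfl⟩⟩ *
      pullHol (C.toTotal φ) (C.preimage_divisor φ) p
        ⟨(z : PunctGerm C.total C.divisor p.snd), ⟨z, hz, rfl⟩⟩ := by
    refine Subtype.ext (Germ.coe_eq.2 ?_)
    refine (key.filter_mono nhdsWithin_le_nhds).mono fun q hq => ?_
    rw [hq, mul_comm]
    rfl
  rw [e]
  exact Ideal.mul_mem_left _ _ (Ideal.mem_map_of_mem _ hzI)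

/-- The map between base changes of `C` induced by a map over `B`. -/
def baseChangeMap {φ : T ⟶ B} {φ' : T' ⟶ B} (χ : T' ⟶ T) (h : χ ≫ φ = φ') :
    (C.pullback φ').total ⟶ (C.pullback φ).total :=
  CplxMan.fibreProduct.lift C.submersion ((C.pullback φ').proj ≫ χ) (C.toTotal φ') (by
    rw [Category.assoc, h]
    exact (CplxMan.fibreProduct.isPullback (φ := φ') C.submersion).w)

theorem pullsBack_baseChangeMap {φ : T ⟶ B} {φ' : T' ⟶ B} (χ : T' ⟶ T) (h : χ ≫ φ = φ') :
    PullsBack (C.baseChangeMap χ h) (C.pullback φ).divisor (C.pullback φ').divisor := by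
  refine PullsBack.of_comp (C.toTotal φ) (C.baseChangeMap χ h) ?_ (C.preimage_divisor φ)
    (C.pullsBack_toTotal φ')
  rw [← C.preimage_divisor φ, ← C.preimage_divisor φ']
  rfl

/-- The functor of irregular types: it sends `φ : T ⟶ B` to the space of global sections of
`t ⊗ (𝒪(kσ) / 𝒪)` on the base change of the family `C` along `φ`, where `σ` is the section of the
base change. To a map over `B` it assigns the pullback of sections along the induced map of base
changes. -/
def irregularTypes (t : Type v) [AddCommGroup t] [Module ℂ t] (k : ℕ) :
    (Over B)ᵒᵖ ⥤ ModuleCat.{max u v} ℂ where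
  obj X := ModuleCat.of ℂ
    (tailSections (C.pullback X.unop.hom).total (C.pullback X.unop.hom).divisor k t)
  map f := ModuleCat.ofHom (pullTails k t (C.pullsBack_baseChangeMap f.unop.left (Over.w f.unop)))
  map_id X := ModuleCat.hom_ext (LinearMap.ext fun s => pullTails_id k t
    (C.pullsBack_baseChangeMap (𝟙 X.unop.left) (Over.w (𝟙 X.unop))) s)
  map_comp f g := ModuleCat.hom_ext (LinearMap.ext fun s => pullTails_comp k t
    (C.pullsBack_baseChangeMap g.unop.left (Over.w g.unop))
    (C.pullsBack_baseChangeMap f.unop.left (Over.w f.unop))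
    (C.pullsBack_baseChangeMap (g.unop ≫ f.unop).left (Over.w (g.unop ≫ f.unop))) s)

end PointedCurve

/-- A holomorphic vector bundle of rank `n` on a complex manifold `B`. -/
structure HolVectorBundle (B : CplxMan.{u}) (n : ℕ) where
  fibre : B → Type
  [addCommGroup : ∀ b, AddCommGroup (fibre b)]
  [module : ∀ b, Module ℂ (fibre b)]
  [topFibre : ∀ b, TopologicalSpace (fibre b)]
  [topTotal : TopologicalSpace (Bundle.TotalSpace (Fin n → ℂ) fibre)]
  [fiberBundle : FiberBundle (Fin n → ℂ) fibre]
  [vectorBundle : VectorBundle ℂ (Fin n → ℂ) fibre]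
  [holomorphic : ContMDiffVectorBundle ω (Fin n → ℂ) fibre B.I]

namespace HolVectorBundle

attribute [instance] addCommGroup module topFibre topTotal fiberBundle vectorBundle holomorphic

variable {B : CplxMan.{u}} {n : ℕ} (V : HolVectorBundle B n)

instance : T2Space (Bundle.TotalSpace (Fin n → ℂ) V.fibre) := by
  refine ⟨fun x y hxy => ?_⟩
  by_cases h : x.proj = y.proj
  · let e := trivializationAt (Fin n → ℂ) V.fibre x.proj
    have hx : x ∈ e.source := e.mem_source.2
      (FiberBundle.mem_baseSet_trivializationAt (Fin n → ℂ) V.fibre x.proj)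
    have hy : y ∈ e.source := e.mem_source.2
      (h ▸ FiberBundle.mem_baseSet_trivializationAt (Fin n → ℂ) V.fibre x.proj)
    have hne : e x ≠ e y := fun he => hxy (e.toOpenPartialHomeomorph.injOn hx hy he)
    obtain ⟨u, v, hu, hv, hxu, hyv, hd⟩ := t2_separation hne
    exact ⟨_, _, e.toOpenPartialHomeomorph.isOpen_inter_preimage hu,
      e.toOpenPartialHomeomorph.isOpen_inter_preimage hv, ⟨hx, hxu⟩, ⟨hy, hyv⟩,
      (hd.preimage e).mono Set.inter_subset_right Set.inter_subset_right⟩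
  · obtain ⟨u, v, hu, hv, hx, hy, hd⟩ := t2_separation h
    have hc := FiberBundle.continuous_proj (Fin n → ℂ) V.fibre
    exact ⟨_, _, hu.preimage hc, hv.preimage hc, hx, hy, hd.preimage _⟩

instance : SecondCountableTopology (Bundle.TotalSpace (Fin n → ℂ) V.fibre) := by
  let e := fun b : B => trivializationAt (Fin n → ℂ) V.fibre b
  obtain ⟨s, hs, hsU⟩ := TopologicalSpace.countable_cover_nhds (fun b : B =>
    (e b).open_baseSet.mem_nhds (FiberBundle.mem_baseSet_trivializationAt (Fin n → ℂ) V.fibre b))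
  have : Countable s := hs
  have (b : s) : SecondCountableTopology (e b).source :=
    (e b).toOpenPartialHomeomorph.secondCountableTopology_source
  refine TopologicalSpace.secondCountableTopology_of_countable_cover
    (fun b : s => (e b).open_source) (Set.eq_univ_of_forall fun x => ?_)
  obtain ⟨b, hb, hx⟩ := Set.mem_iUnion₂.1 (hsU.symm ▸ Set.mem_univ x.proj)
  exact Set.mem_iUnion.2 ⟨⟨b, hb⟩, (e b).mem_source.2 hx⟩

/-- The total space of a holomorphic vector bundle, as a complex manifold. -/
def total : CplxMan.{u} where
  carrier := Bundle.TotalSpace (Fin n → ℂ) V.fibre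
  E := B.E × (Fin n → ℂ)
  H := ModelProd B.H (Fin n → ℂ)
  I := B.I.prod 𝓘(ℂ, Fin n → ℂ)
  isManifold := Bundle.TotalSpace.isManifold (Fin n → ℂ) V.fibre

/-- The projection of a holomorphic vector bundle to its base. -/
def proj : V.total ⟶ B := ⟨Bundle.TotalSpace.proj, by
  have h : ContMDiff (B.I.prod 𝓘(ℂ, Fin n → ℂ)) B.I ω
      (Bundle.TotalSpace.proj : Bundle.TotalSpace (Fin n → ℂ) V.fibre → B) :=
    Bundle.contMDiff_proj V.fibre
  exact h⟩

variable {V} in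
/-- `h₃ = c • h₁ + h₂` for maps over `B` to a vector bundle, computed in the fibres. -/
def IsLinComb {X : Over B} (c : ℂ) (h₁ h₂ h₃ : X ⟶ Over.mk V.proj) : Prop :=
  ∀ x : X.left, ∃ (b : B) (v w : V.fibre b),
    h₁.left x = (⟨b, v⟩ : Bundle.TotalSpace (Fin n → ℂ) V.fibre) ∧
    h₂.left x = (⟨b, w⟩ : Bundle.TotalSpace (Fin n → ℂ) V.fibre) ∧
    h₃.left x = (⟨b, c • v + w⟩ : Bundle.TotalSpace (Fin n → ℂ) V.fibre)

end HolVectorBundle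

end

/-!
The functor is represented by the bundle whose fibre at `b` is the space of `r`-tuples of principal
parts of order at most `k` at the point `σ(b)` of the fibre over `b`.

Near a point of the section choose a local equation `z` of it (`PointedCurve.localEq_coord`): a
fibre coordinate, centred at the section. A holomorphic function `a` near the section differs from
`a ∘ σ ∘ π` by a multiple of `z`; iterating this, `a` is a polynomial of degree less than `k` in
`z`, with coefficients holomorphic on the base, plus a multiple of `z ^ k`, and the coefficients are
unique (`LocalEq.exists_expansion`, `LocalEq.expansion_unique`). Dividing by `z ^ k`, every germ of
`𝒪(kσ)` has a principal part `∑ j < k, c j * z ^ (j - k)` with `c j` holomorphic on the base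
(`LocalEq.exists_hasPrincipalPart`). Hence a section of `𝒪(kσ) / 𝒪` is locally the same thing as a
holomorphic map from the base to `ℂ ^ k`, and tensoring with `t` gives maps to `ℂ ^ (r * k)`.

Two local equations `z` and `w` differ by the matrix of the principal parts of `z ^ (l - k)` with
respect to `w`. It depends holomorphically on the base point and satisfies the cocycle condition
because principal parts are linear over functions on the base (`tailCoef_eq_sum_trans`,
`holAt_trans`), so it defines a holomorphic vector bundle (`Frame.core`). On a single family with a
`Frame` of local equations, global sections are identified with the holomorphic sections of that
bundle (`Frame.coords_injective`, `Frame.holSectionAt_coords`, `Frame.exists_coords_eq`). Local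
equations, principal parts and transition matrices are compatible with base change
(`LocalEq.pullback`, `HasPrincipalPart.pullback`, `Frame.change_pull`), so a section on the base
change along `φ` is a holomorphic section of the pulled back bundle, that is, a holomorphic map over
the base to the total space; this is natural and linear.
-/

noncomputable section

/-! ### Principal parts along a section -/

/-- `f` is holomorphic at `x`. -/
abbrev CplxMan.HolAt {X : CplxMan.{u}} (f : X → ℂ) (x : X) : Prop :=
  ContMDiffAt X.I 𝓘(ℂ) ω f x

theorem CplxMan.HolAt.eventually {X : CplxMan.{u}} {f : X → ℂ} {x : X} (hf : HolAt f x) :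
    ∀ᶠ y in 𝓝 x, HolAt f y := by
  obtain ⟨U, hU, hfU⟩ := (contMDiffAt_iff_contMDiffOn_nhds (by decide)).1 hf
  filter_upwards [eventually_mem_nhds_iff.2 hU] with y hy using hfU.contMDiffAt hy

open CplxMan

namespace PointedCurve

variable {B : CplxMan.{u}} (C : PointedCurve B)

theorem sec_proj_of_mem {x : C.total} (hx : x ∈ C.divisor) : C.sec (C.proj x) = x := by
  obtain ⟨b, rfl⟩ := hx
  rw [C.proj_sec]

theorem sec_mem_divisor (b : B) : C.sec b ∈ C.divisor := ⟨b, rfl⟩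

/-- Within a fibre, the section meets only one point, so its complement accumulates there. -/
theorem dense_compl_divisor : Dense C.divisorᶜ := by
  intro x
  let K := C.submersion.chart x
  have hx : x ∈ K.source := C.submersion.mem_chart_source x
  let g : ℂ → C.total := fun w => K.symm ((K x).1, w)
  have hline : Continuous fun w : ℂ => ((K x).1, w) := by fun_prop
  have hg0 : g (K x).2 = x := K.left_inv hx
  have hgt : Tendsto g (𝓝[≠] (K x).2) (𝓝 x) := by
    have h1 : ContinuousAt g (K x).2 :=
      ContinuousAt.comp (g := K.symm) (K.continuousAt_symm (K.map_source hx)) hline.continuousAt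
    have h2 := h1.tendsto
    rw [hg0] at h2
    exact h2.mono_left nhdsWithin_le_nhds
  have hproj : ∀ w, ((K x).1, w) ∈ K.target → C.proj (g w) = C.proj x := by
    intro w hw
    have h1 := K.map_target hw
    refine (C.submersion.baseChart x).injOn (C.submersion.mem_baseChart_source x h1)
      (C.submersion.mem_baseChart_source x hx) ?_
    rw [← C.submersion.chart_fst x h1, ← C.submersion.chart_fst x hx]
    change (K (g w)).1 = (K x).1
    rw [K.right_inv hw]
  have ht : ∀ᶠ w in 𝓝 (K x).2, ((K x).1, w) ∈ K.target :=
    hline.continuousAt.eventually_mem (K.open_target.mem_nhds (K.map_source hx))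
  by_cases hxD : x ∈ C.divisor
  · refine mem_closure_of_tendsto hgt ?_
    filter_upwards [ht.filter_mono nhdsWithin_le_nhds, self_mem_nhdsWithin] with w hw hne hD
    have h1 := C.sec_proj_of_mem hD
    rw [hproj w hw, C.sec_proj_of_mem hxD] at h1
    have h2 : K x = ((K x).1, w) := (congrArg K h1).trans (K.right_inv hw)
    exact hne (congrArg Prod.snd h2).symm
  · exact subset_closure hxD

/-- Functions holomorphic at `x` which agree near `x` off the section agree near `x`. -/
theorem eventually_eq_of_punctured {f g : C.total → ℂ} {x : C.total} (hf : HolAt f x)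
    (hg : HolAt g x) (h : f =ᶠ[𝓝[C.divisorᶜ] x] g) : f =ᶠ[𝓝 x] g := by
  have h1 : ∀ᶠ y in 𝓝 x, f =ᶠ[𝓝[C.divisorᶜ] y] g :=
    eventually_nhds_nhdsWithin.2 h
  filter_upwards [hf.eventually, hg.eventually, h1] with y hy1 hy2 hy3
  have : (𝓝[C.divisorᶜ] y).NeBot := mem_closure_iff_nhdsWithin_neBot.1 (C.dense_compl_divisor y)
  have h2 : Tendsto f (𝓝[C.divisorᶜ] y) (𝓝 (f y)) :=
    hy1.continuousAt.tendsto.mono_left nhdsWithin_le_nhds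
  have h3 : Tendsto g (𝓝[C.divisorᶜ] y) (𝓝 (g y)) :=
    hy2.continuousAt.tendsto.mono_left nhdsWithin_le_nhds
  exact tendsto_nhds_unique (h2.congr' hy3) h3

/-- `z` is a local equation of the section of `C` at the point `x` of its image: it is
holomorphic, it vanishes exactly on the section, and it generates the ideal of the section. -/
structure LocalEq (z : C.total → ℂ) (x : C.total) : Prop where
  mem : x ∈ C.divisor
  hol : HolAt z x
  zero : ∀ᶠ y in 𝓝[C.divisor] x, z y = 0
  ne_zero : ∀ᶠ y in 𝓝[C.divisorᶜ] x, z y ≠ 0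
  ideal_le : idealGerm C.total C.divisor x ≤
    Ideal.span {⟨(z : PunctGerm C.total C.divisor x), ⟨z, hol, rfl⟩⟩}

variable {C}

theorem holAt_comp_proj {c : B → ℂ} {x : C.total} (hc : HolAt c (C.proj x)) :
    HolAt (fun y => c (C.proj y)) x :=
  ContMDiffAt.comp x hc (C.proj.contMDiff x)

theorem holAt_comp_sec {f : C.total → ℂ} {b : B} (hf : HolAt f (C.sec b)) :
    HolAt (fun b => f (C.sec b)) b :=
  ContMDiffAt.comp b hf (C.sec.contMDiff b)

theorem tendsto_sec {x : C.total} (hx : x ∈ C.divisor) :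
    Tendsto C.sec (𝓝 (C.proj x)) (𝓝[C.divisor] x) := by
  refine tendsto_nhdsWithin_iff.2 ⟨?_, Eventually.of_forall C.sec_mem_divisor⟩
  exact (C.sec.contMDiff.continuous.tendsto (C.proj x)).mono_right
    (congrArg 𝓝 (C.sec_proj_of_mem hx)).le

namespace LocalEq

variable {z : C.total → ℂ} {x : C.total} (h : C.LocalEq z x)
include h

/-- A holomorphic function that vanishes on the section is divisible by the local equation. -/
theorem exists_eq_mul {f : C.total → ℂ} (hf : HolAt f x) (hf0 : ∀ᶠ y in 𝓝[C.divisor] x, f y = 0) :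
    ∃ a : C.total → ℂ, HolAt a x ∧ f =ᶠ[𝓝[C.divisorᶜ] x] fun y => z y * a y := by
  have h1 := h.ideal_le (show (⟨(f : PunctGerm C.total C.divisor x), ⟨f, hf, rfl⟩⟩ :
    holGerm C.total C.divisor x) ∈ _ from ⟨f, hf, hf0, rfl⟩)
  obtain ⟨⟨_, a, ha, rfl⟩, e⟩ := Ideal.mem_span_singleton'.1 h1
  refine ⟨a, ha, ?_⟩
  have e' : ((a * z : C.total → ℂ) : PunctGerm C.total C.divisor x) = f := congrArg Subtype.val e
  filter_upwards [Germ.coe_eq.1 e'] with y hy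
  rw [← hy, mul_comm]
  rfl

/-- Division with remainder by powers of the local equation. -/
theorem exists_expansion (k : ℕ) {f : C.total → ℂ} (hf : HolAt f x) :
    ∃ (c : ℕ → B → ℂ) (r : C.total → ℂ), (∀ j, HolAt (c j) (C.proj x)) ∧ HolAt r x ∧
      f =ᶠ[𝓝[C.divisorᶜ] x]
        fun y => ∑ j ∈ Finset.range k, c j (C.proj y) * z y ^ j + z y ^ k * r y := by
  induction k with
  | zero => exact ⟨0, f, fun _ => contMDiffAt_const, hf, Eventually.of_forall fun y => by simp⟩
  | succ k ih =>
    obtain ⟨c, r, hc, hr, e⟩ := ih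
    have hx := C.sec_proj_of_mem h.mem
    have hr0 : HolAt (fun b => r (C.sec b)) (C.proj x) := holAt_comp_sec (by rwa [hx])
    obtain ⟨a, ha, e'⟩ := h.exists_eq_mul (f := fun y => r y - r (C.sec (C.proj y)))
      (hr.sub (holAt_comp_proj hr0)) (eventually_nhdsWithin_of_forall fun y hy => by
        rw [C.sec_proj_of_mem hy, sub_self])
    refine ⟨fun j => if j = k then fun b => r (C.sec b) else c j, a, fun j => ?_, ha, ?_⟩
    · dsimp only
      split_ifs
      exacts [hr0, hc j]
    · filter_upwards [e, e'] with y h1 h2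
      rw [h1, Finset.sum_range_succ, if_pos rfl]
      have h3 : ∑ j ∈ Finset.range k, (if j = k then fun b => r (C.sec b) else c j) (C.proj y)
          * z y ^ j = ∑ j ∈ Finset.range k, c j (C.proj y) * z y ^ j :=
        Finset.sum_congr rfl fun j hj => by rw [if_neg (Finset.mem_range.1 hj).ne]
      rw [h3]
      have h4 : r y = r (C.sec (C.proj y)) + z y * a y := by rw [← h2]; ring
      rw [h4]
      ring

/-- Uniqueness of the expansion in powers of the local equation. -/
theorem expansion_unique (k : ℕ) {c : ℕ → B → ℂ} {r : C.total → ℂ}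
    (hc : ∀ j, HolAt (c j) (C.proj x)) (hr : HolAt r x)
    (e : (fun y => ∑ j ∈ Finset.range k, c j (C.proj y) * z y ^ j) =ᶠ[𝓝[C.divisorᶜ] x]
      fun y => z y ^ k * r y) : ∀ j < k, c j =ᶠ[𝓝 (C.proj x)] 0 := by
  induction k generalizing c with
  | zero => intro j hj; omega
  | succ k ih =>
    have e1 := C.eventually_eq_of_punctured
      (ContMDiffAt.sum fun j _ => (holAt_comp_proj (hc j)).mul (h.hol.pow j))
      ((h.hol.pow (k + 1)).mul hr) e
    have h0 : c 0 =ᶠ[𝓝 (C.proj x)] 0 := by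
      have h1 := (tendsto_sec h.mem).eventually (h.zero.and (e1.filter_mono nhdsWithin_le_nhds))
      filter_upwards [h1] with b hb
      obtain ⟨hb1, hb2⟩ := hb
      simpa [hb1, Finset.sum_range_succ', C.proj_sec] using hb2
    have hproj : Tendsto C.proj (𝓝[C.divisorᶜ] x) (𝓝 (C.proj x)) :=
      (C.proj.contMDiff.continuous.tendsto x).mono_left nhdsWithin_le_nhds
    have ih' := ih (c := fun j => c (j + 1)) (fun j => hc _) (by
      filter_upwards [e, h.ne_zero, hproj.eventually h0] with y h1 h2 h3
      refine mul_left_cancel₀ h2 ?_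
      rw [Finset.sum_range_succ', h3] at h1
      rw [Finset.mul_sum, ← mul_assoc, ← pow_succ', ← h1]
      simp only [Pi.zero_apply, zero_mul, add_zero]
      exact Finset.sum_congr rfl fun j _ => by ring)
    rintro (_ | j) hj
    exacts [h0, ih' j (by omega)]

end LocalEq

variable {k : ℕ}

/-- The polar function `∑ j < k, c j * z ^ (j - k)`, the `c j` being functions on the base. -/
def polar (C : PointedCurve B) (z : C.total → ℂ) (c : Fin k → B → ℂ) : C.total → ℂ :=
  fun y => (∑ j, c j (C.proj y) * z y ^ (j : ℕ)) / z y ^ k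

/-- The germ `m` is congruent, modulo holomorphic germs, to the polar function with coefficients
`c`, which are holomorphic at the base point of `x`. -/
structure HasPrincipalPart (C : PointedCurve B) (z : C.total → ℂ) (x : C.total)
    (m : PunctGerm C.total C.divisor x) (c : Fin k → B → ℂ) : Prop where
  hol : ∀ j, HolAt (c j) (C.proj x)
  sub_mem : m - (C.polar z c : PunctGerm C.total C.divisor x) ∈ holGerm C.total C.divisor x

theorem polar_add (z : C.total → ℂ) (c c' : Fin k → B → ℂ) :
    C.polar z (c + c') = C.polar z c + C.polar z c' := by
  funext y
  simp only [polar, Pi.add_apply, add_mul, Finset.sum_add_distrib, add_div]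

theorem polar_smul (z : C.total → ℂ) (a : B → ℂ) (c : Fin k → B → ℂ) :
    C.polar z (fun j b => a b * c j b) = (fun y => a (C.proj y)) * C.polar z c := by
  funext y
  simp only [polar, Pi.mul_apply, mul_assoc, ← Finset.mul_sum, mul_div_assoc]

theorem polar_sum {ι : Type*} (s : Finset ι) (z : C.total → ℂ) (c : ι → Fin k → B → ℂ) :
    C.polar z (∑ i ∈ s, c i) = ∑ i ∈ s, C.polar z (c i) := by
  classical
  induction s using Finset.induction_on with
  | empty => funext y; simp [polar]
  | insert i s hi ih => rw [Finset.sum_insert hi, Finset.sum_insert hi, polar_add, ih]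

theorem mem_holGerm_of_holAt {D : Set C.total} {f : C.total → ℂ} {x : C.total} (hf : HolAt f x) :
    (f : PunctGerm C.total D x) ∈ holGerm C.total D x := ⟨f, hf, rfl⟩

namespace HasPrincipalPart

variable {z : C.total → ℂ} {x : C.total} {m m' : PunctGerm C.total C.divisor x}
  {c c' : Fin k → B → ℂ}

theorem add (h : C.HasPrincipalPart z x m c) (h' : C.HasPrincipalPart z x m' c') :
    C.HasPrincipalPart z x (m + m') (c + c') := by
  refine ⟨fun j => (h.hol j).add (h'.hol j), ?_⟩
  have e : m + m' - (C.polar z (c + c') : PunctGerm C.total C.divisor x) =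
      (m - (C.polar z c : PunctGerm C.total C.divisor x)) +
        (m' - (C.polar z c' : PunctGerm C.total C.divisor x)) := by
    rw [polar_add, Germ.coe_add]; ring
  rw [e]
  exact add_mem h.sub_mem h'.sub_mem

/-- Principal parts are linear over holomorphic functions on the base. -/
theorem mul {a : B → ℂ} (ha : HolAt a (C.proj x)) (h : C.HasPrincipalPart z x m c) :
    C.HasPrincipalPart z x (((fun y => a (C.proj y) : C.total → ℂ) :
      PunctGerm C.total C.divisor x) * m) (fun j b => a b * c j b) := by
  refine ⟨fun j => ha.mul (h.hol j), ?_⟩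
  rw [polar_smul, Germ.coe_mul, ← mul_sub]
  exact mul_mem (mem_holGerm_of_holAt (holAt_comp_proj ha)) h.sub_mem

theorem smul (a : ℂ) (h : C.HasPrincipalPart z x m c) :
    C.HasPrincipalPart z x (a • m) (fun j b => a * c j b) := by
  have h1 := h.mul (a := fun _ => a) contMDiffAt_const
  have e : ((fun _ => a : C.total → ℂ) : PunctGerm C.total C.divisor x) * m = a • m :=
    Quotient.inductionOn' m fun _ => rfl
  rwa [e] at h1

theorem of_mem_holGerm (hm : m ∈ holGerm C.total C.divisor x) :
    C.HasPrincipalPart z x m (0 : Fin k → B → ℂ) := by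
  refine ⟨fun j => contMDiffAt_const, ?_⟩
  have e : C.polar z (0 : Fin k → B → ℂ) = 0 := by funext y; simp [polar]
  rw [e, Germ.coe_zero, sub_zero]
  exact hm

theorem zero : C.HasPrincipalPart z x 0 (0 : Fin k → B → ℂ) := of_mem_holGerm (zero_mem _)

theorem sum {ι : Type*} (s : Finset ι) {m : ι → PunctGerm C.total C.divisor x}
    {c : ι → Fin k → B → ℂ} (h : ∀ i ∈ s, C.HasPrincipalPart z x (m i) (c i)) :
    C.HasPrincipalPart z x (∑ i ∈ s, m i) (∑ i ∈ s, c i) := by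
  classical
  induction s using Finset.induction_on with
  | empty => simpa using zero
  | insert i s hi ih =>
    rw [Finset.sum_insert hi, Finset.sum_insert hi]
    exact (h i (Finset.mem_insert_self i s)).add (ih fun j hj => h j (Finset.mem_insert_of_mem hj))

theorem add_holGerm (h : C.HasPrincipalPart z x m c) (hm' : m' ∈ holGerm C.total C.divisor x) :
    C.HasPrincipalPart z x (m + m') c := by
  simpa using h.add (of_mem_holGerm (z := z) hm')

theorem polar (hc : ∀ j, HolAt (c j) (C.proj x)) :
    C.HasPrincipalPart z x (C.polar z c : PunctGerm C.total C.divisor x) c :=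
  ⟨hc, by rw [sub_self]; exact zero_mem _⟩

/-- A function having a principal part at a point of the section has the same principal part at
the nearby points. -/
theorem eventually {f : C.total → ℂ} (hx : x ∈ C.divisor)
    (h : C.HasPrincipalPart z x (f : PunctGerm C.total C.divisor x) c) :
    ∀ᶠ b in 𝓝 (C.proj x),
      C.HasPrincipalPart z (C.sec b) (f : PunctGerm C.total C.divisor (C.sec b)) c := by
  obtain ⟨r, hr, e⟩ := h.sub_mem
  have e1 : r =ᶠ[𝓝[C.divisorᶜ] x] f - C.polar z c := Germ.coe_eq.1 e
  have h1 : ∀ᶠ y in 𝓝[C.divisor] x, HolAt r y ∧ r =ᶠ[𝓝[C.divisorᶜ] y] f - C.polar z c :=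
    ((HolAt.eventually hr).and (eventually_nhds_nhdsWithin.2 e1)).filter_mono nhdsWithin_le_nhds
  filter_upwards [(tendsto_sec hx).eventually h1,
    eventually_all.2 fun j => (h.hol j).eventually] with b hb hb'
  refine ⟨by rwa [C.proj_sec], r, hb.1, Germ.coe_eq.2 hb.2⟩

theorem unique (hz : C.LocalEq z x) (h : C.HasPrincipalPart z x m c)
    (h' : C.HasPrincipalPart z x m c') (j : Fin k) : c j (C.proj x) = c' j (C.proj x) := by
  have h1 : C.HasPrincipalPart z x 0 (fun j b => c j b + -1 * c' j b) := by
    have := h.add (h'.smul (-1))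
    rwa [neg_one_smul, add_neg_cancel] at this
  obtain ⟨r, hr, e⟩ := h1.sub_mem
  let d : ℕ → B → ℂ := fun j => if hj : j < k then fun b => c ⟨j, hj⟩ b + -1 * c' ⟨j, hj⟩ b else 0
  have hd : ∀ j, HolAt (d j) (C.proj x) := by
    intro j
    dsimp only [d]
    split_ifs
    exacts [h1.hol _, contMDiffAt_const]
  have e' : (-r) =ᶠ[𝓝[C.divisorᶜ] x] C.polar z (fun j b => c j b + -1 * c' j b) := by
    refine Germ.coe_eq.1 ?_
    rw [Germ.coe_neg, e, zero_sub, neg_neg]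
  have h2 := hz.expansion_unique k hd hr.neg (by
    filter_upwards [e', hz.ne_zero] with y h1 h2
    change _ = z y ^ k * (-r) y
    rw [h1, PointedCurve.polar, mul_div_cancel₀ _ (pow_ne_zero _ h2), Finset.sum_range]
    refine Finset.sum_congr rfl fun j _ => ?_
    simp only [d, dif_pos j.2]) j j.2
  have h3 : c j (C.proj x) + -1 * c' j (C.proj x) = 0 := by
    have := h2.self_of_nhds
    simpa only [d, dif_pos j.2, Pi.zero_apply] using this
  linear_combination h3

end HasPrincipalPart

namespace LocalEq

variable {z : C.total → ℂ} {x : C.total} (h : C.LocalEq z x)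
include h

/-- Together with `LocalEq.mem_poleGerm`: the stalk of `𝒪(kσ)`, defined as the inverse of `ℐ ^ k`,
consists of the germs with a principal part of order at most `k`. -/
theorem exists_hasPrincipalPart {m : PunctGerm C.total C.divisor x}
    (hm : m ∈ poleGerm C.total C.divisor k x) :
    ∃ c : Fin k → B → ℂ, C.HasPrincipalPart z x m c := by
  induction m using Germ.inductionOn with | _ f
  have hzI : (⟨(z : PunctGerm C.total C.divisor x), ⟨z, h.hol, rfl⟩⟩ :
      holGerm C.total C.divisor x) ∈ idealGerm C.total C.divisor x := ⟨z, h.hol, h.zero, rfl⟩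
  obtain ⟨a, ha, e⟩ := hm _ (Ideal.pow_mem_pow hzI k)
  have e : (a : PunctGerm C.total C.divisor x) = ((z ^ k * f : C.total → ℂ) :
    PunctGerm C.total C.divisor x) := e
  obtain ⟨c, r, hc, hr, e'⟩ := h.exists_expansion k ha
  refine ⟨fun j => c j, fun j => hc j, r, hr, Germ.coe_eq.2 ?_⟩
  filter_upwards [Germ.coe_eq.1 e, e', h.ne_zero] with y h1 h2 h3
  have h4 : z y ^ k * f y = a y := h1.symm
  have h5 := pow_ne_zero k h3
  rw [h2, Finset.sum_range] at h4
  change r y = f y - C.polar z _ y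
  rw [PointedCurve.polar, eq_sub_iff_add_eq]
  refine mul_left_cancel₀ h5 ?_
  rw [h4, mul_add, mul_div_cancel₀ _ h5, add_comm]

theorem mem_poleGerm {m : PunctGerm C.total C.divisor x} {c : Fin k → B → ℂ}
    (hm : C.HasPrincipalPart z x m c) : m ∈ poleGerm C.total C.divisor k x := by
  have h1 : (C.polar z c : PunctGerm C.total C.divisor x) ∈ poleGerm C.total C.divisor k x := by
    intro a ha
    have h2 := Ideal.pow_right_mono h.ideal_le k ha
    rw [Ideal.span_singleton_pow] at h2
    obtain ⟨a', rfl⟩ := Ideal.mem_span_singleton'.1 h2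
    rw [MulMemClass.coe_mul, mul_assoc]
    refine mul_mem a'.2 ⟨fun y => ∑ j, c j (C.proj y) * z y ^ (j : ℕ),
      ContMDiffAt.sum fun j _ => (holAt_comp_proj (hm.hol j)).mul (h.hol.pow j), ?_⟩
    change _ = ((z ^ k * C.polar z c : C.total → ℂ) : PunctGerm C.total C.divisor x)
    refine Germ.coe_eq.2 ?_
    filter_upwards [h.ne_zero] with y hy
    rw [Pi.mul_apply, Pi.pow_apply, PointedCurve.polar, mul_div_cancel₀ _ (pow_ne_zero k hy)]
  have h3 : m - (C.polar z c : PunctGerm C.total C.divisor x) ∈ poleGerm C.total C.divisor k x :=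
    fun a _ => mul_mem a.2 hm.sub_mem
  simpa using add_mem h3 h1

end LocalEq

end PointedCurve

/-! ### Existence and base change of local equations -/

theorem CplxMan.IsRelCurve.contMDiffOn_baseChart_symm {B S : CplxMan.{u}} {π : S ⟶ B}
    (hπ : IsRelCurve π) (x : S) :
    ContMDiffOn 𝓘(ℂ, B.E) B.I ω (hπ.baseChart x).symm (hπ.baseChart x).target := by
  have h1 := contMDiffOn_symm_of_mem_maximalAtlas (hπ x).codChart_mem_maximalAtlas
  have h2 : ContMDiff 𝓘(ℂ, B.E) B.I ω B.I.symm := by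
    rw [← contMDiffOn_univ, ← B.I.range_eq_univ]
    exact B.I.contMDiffOn_symm
  exact h1.comp h2.contMDiffOn (fun y hy => hy)

namespace PointedCurve

variable {B : CplxMan.{u}} (C : PointedCurve B)

/-- The fibre coordinate of the chart of `C.total` around `C.sec i`, centred at the section. -/
def coord (i : B) (y : C.total) : ℂ :=
  (C.submersion.chart (C.sec i) y).2 - (C.submersion.chart (C.sec i) (C.sec (C.proj y))).2

/-- The set of those `b` for which `C.sec b` lies in the chart around `C.sec i`. -/
def coordSet (i : B) : Set B := C.sec ⁻¹' (C.submersion.chart (C.sec i)).source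

theorem isOpen_coordSet (i : B) : IsOpen (C.coordSet i) :=
  (C.submersion.chart (C.sec i)).open_source.preimage C.sec.contMDiff.continuous

theorem mem_coordSet (i : B) : i ∈ C.coordSet i := C.submersion.mem_chart_source (C.sec i)

/-- The centred fibre coordinate is a local equation: in the coordinates given by the base and by
`C.coord i` the section is the zero section, so that `exists_eq_snd_mul` applies. -/
theorem localEq_coord {i b : B} (hb : b ∈ C.coordSet i) : C.LocalEq (C.coord i) (C.sec b) := by
  let hπ := C.submersion
  let x := C.sec b
  let K := hπ.chart (C.sec i)
  let χ := hπ.baseChart (C.sec i)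
  let z := C.coord i
  have hx : x ∈ K.source := hb
  have hpx : C.proj x = b := C.proj_sec b
  have hsp : C.sec (C.proj x) = x := congrArg C.sec hpx
  have hsnd : ContMDiff 𝓘(ℂ, B.E × ℂ) 𝓘(ℂ, ℂ) ω (Prod.snd : B.E × ℂ → ℂ) :=
    contDiff_snd.contMDiff
  have hfst : ContMDiff 𝓘(ℂ, B.E × ℂ) 𝓘(ℂ, B.E) ω (Prod.fst : B.E × ℂ → B.E) :=
    contDiff_fst.contMDiff
  have hK : ContMDiffAt C.total.I 𝓘(ℂ, B.E × ℂ) ω K x :=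
    (hπ.contMDiffOn_chart (C.sec i)).contMDiffAt (K.open_source.mem_nhds hx)
  have hK2 : HolAt (fun y => (K y).2) x := hsnd.contMDiffAt.comp x hK
  have hsecproj : ContMDiffAt C.total.I C.total.I ω (fun y => C.sec (C.proj y)) x :=
    (C.sec.contMDiff.comp C.proj.contMDiff) x
  have hsK : ∀ᶠ y in 𝓝 x, C.sec (C.proj y) ∈ K.source :=
    hsecproj.continuousAt.eventually_mem (K.open_source.mem_nhds (hsp.symm ▸ hx))
  have hz : HolAt z x := by
    refine hK2.sub ?_
    exact ContMDiffAt.comp (g := fun y => (K y).2) x (by rw [hsp]; exact hK2) hsecproj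
  -- the two points `y` and `sec (proj y)` have the same base coordinate
  have hK1 : ∀ y ∈ K.source, C.sec (C.proj y) ∈ K.source →
      (K y).1 = (K (C.sec (C.proj y))).1 := by
    intro y hy hy'
    rw [hπ.chart_fst _ hy, hπ.chart_fst _ hy', C.proj_sec]
  refine ⟨C.sec_mem_divisor b, hz, ?_, ?_, ?_⟩
  · refine eventually_nhdsWithin_of_forall fun y hy => ?_
    change (K y).2 - (K (C.sec (C.proj y))).2 = 0
    rw [C.sec_proj_of_mem hy, sub_self]
  · filter_upwards [(K.open_source.eventually_mem hx).filter_mono nhdsWithin_le_nhds,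
      hsK.filter_mono nhdsWithin_le_nhds, self_mem_nhdsWithin] with y h1 h2 h3 h4
    refine h3 ⟨C.proj y, (K.injOn h1 h2 (Prod.ext (hK1 y h1 h2) ?_)).symm⟩
    exact sub_eq_zero.1 h4
  rintro ⟨_, _⟩ ⟨f, hf, hf0, rfl⟩
  let v₀ : B.E := χ b
  have hbχ : b ∈ χ.source := hpx ▸ hπ.mem_baseChart_source (C.sec i) hx
  have hv₀ : χ.symm v₀ = b := χ.left_inv hbχ
  have hKx1 : (K x).1 = v₀ := by rw [hπ.chart_fst _ hx, hpx]
  have hχ : ContMDiffAt 𝓘(ℂ, B.E) B.I ω χ.symm v₀ :=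
    (hπ.contMDiffOn_baseChart_symm (C.sec i)).contMDiffAt
      (χ.open_target.mem_nhds (χ.map_source hbχ))
  -- the section, as a function of the base coordinate
  let s : B.E → C.total := fun v => C.sec (χ.symm v)
  have hs : ContMDiffAt 𝓘(ℂ, B.E) C.total.I ω s v₀ :=
    C.sec.contMDiff.contMDiffAt.comp v₀ hχ
  have hs₀ : s v₀ = x := congrArg C.sec hv₀
  have hs2 : ContMDiffAt 𝓘(ℂ, B.E) 𝓘(ℂ) ω (fun v => (K (s v)).2) v₀ :=
    ContMDiffAt.comp (g := fun y => (K y).2) v₀ (by rw [hs₀]; exact hK2) hs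
  -- the inverse of the coordinate system `((K y).1, z y)`
  let G₀ : B.E × ℂ → B.E × ℂ := fun w => (w.1, w.2 + (K (s w.1)).2)
  have hG₀ : ContMDiffAt 𝓘(ℂ, B.E × ℂ) 𝓘(ℂ, B.E × ℂ) ω G₀ (v₀, 0) :=
    hfst.contMDiffAt.prodMk_space
      (hsnd.contMDiffAt.add (ContMDiffAt.comp (g := fun v => (K (s v)).2) (v₀, (0 : ℂ)) hs2
        hfst.contMDiffAt))
  have hG₀p : G₀ (v₀, 0) = K x := by
    refine Prod.ext hKx1.symm ?_
    change 0 + (K (s v₀)).2 = _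
    rw [hs₀, zero_add]
  let G : B.E × ℂ → C.total := fun w => K.symm (G₀ w)
  have hGp : G (v₀, 0) = x := by
    change K.symm (G₀ (v₀, 0)) = x
    rw [hG₀p, K.left_inv hx]
  have hG : ContMDiffAt 𝓘(ℂ, B.E × ℂ) C.total.I ω G (v₀, 0) := by
    refine ContMDiffAt.comp _ (g := K.symm) ?_ hG₀
    rw [hG₀p]
    exact (hπ.contMDiffOn_chart_symm (C.sec i)).contMDiffAt
      (K.open_target.mem_nhds (K.map_source hx))
  have hfG : AnalyticAt ℂ (f ∘ G) (v₀, 0) := by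
    have h1 : ContMDiffAt 𝓘(ℂ, B.E × ℂ) 𝓘(ℂ) ω (f ∘ G) (v₀, 0) :=
      ContMDiffAt.comp _ (by rw [hGp]; exact hf) hG
    exact (contMDiffAt_iff_contDiffAt.1 h1).analyticAt
  have hfG0 : ∀ᶠ v in 𝓝 v₀, (f ∘ G) (v, 0) = 0 := by
    have h1 : ∀ᶠ v in 𝓝 v₀, v ∈ χ.target := χ.open_target.mem_nhds (χ.map_source hbχ)
    have h2 : ∀ᶠ v in 𝓝 v₀, s v ∈ K.source :=
      hs.continuousAt.eventually_mem (K.open_source.mem_nhds (by rw [hs₀]; exact hx))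
    have h3 : Tendsto s (𝓝 v₀) (𝓝[C.divisor] x) :=
      tendsto_nhdsWithin_iff.2 ⟨by simpa only [hs₀] using hs.continuousAt.tendsto,
        Eventually.of_forall fun v => C.sec_mem_divisor _⟩
    filter_upwards [h1, h2, h3.eventually hf0] with v hv1 hv2 hv3
    have e : G (v, 0) = s v := by
      change K.symm (v, 0 + (K (s v)).2) = s v
      have h4 : (K (s v)).1 = v := by
        rw [hπ.chart_fst _ hv2]
        change χ (C.proj (C.sec (χ.symm v))) = v
        rw [C.proj_sec, χ.right_inv hv1]
      rw [zero_add]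
      refine Eq.trans ?_ (K.left_inv hv2)
      congr 1
      exact Prod.ext h4.symm rfl
    change f (G (v, 0)) = 0
    rw [e, hv3]
  obtain ⟨a, ha, hfa⟩ := exists_eq_snd_mul hfG hfG0
  let w : C.total → B.E × ℂ := fun y => ((K y).1, z y)
  have hwp : w x = (v₀, 0) := by
    refine Prod.ext hKx1 ?_
    change (K x).2 - (K (C.sec (C.proj x))).2 = 0
    rw [hsp, sub_self]
  have hw : ContMDiffAt C.total.I 𝓘(ℂ, B.E × ℂ) ω w x :=
    (hfst.contMDiffAt.comp x hK).prodMk_space hz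
  have haw : HolAt (a ∘ w) x := by
    refine ContMDiffAt.comp x ?_ hw
    rw [hwp]
    exact ha.contDiffAt.contMDiffAt
  refine Ideal.mem_span_singleton'.2 ⟨⟨_, mem_holGerm_of_holAt haw⟩, Subtype.ext ?_⟩
  refine Germ.coe_eq.2 (Filter.Eventually.filter_mono nhdsWithin_le_nhds ?_)
  filter_upwards [hw.continuousAt.eventually (hwp.symm ▸ hfa), K.open_source.mem_nhds hx, hsK]
    with y h1 h2 h3
  have h4 : G (w y) = y := by
    refine Eq.trans ?_ (K.left_inv h2)
    change K.symm _ = K.symm _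
    congr 1
    refine Prod.ext rfl ?_
    change (K y).2 - (K (C.sec (C.proj y))).2 + (K (C.sec (χ.symm (K y).1))).2 = (K y).2
    rw [hπ.chart_fst _ h2, χ.left_inv (hπ.mem_baseChart_source _ h2), sub_add_cancel]
  have h5 : f (G (w y)) = z y * a (w y) := h1
  rw [h4] at h5
  change a (w y) * z y = f y
  rw [h5, mul_comm]

variable {C} {T : CplxMan.{u}} {C' : PointedCurve T} {ψ : C'.total ⟶ C.total} {χ : T → B}

/-- Local equations pull back to local equations. -/
theorem LocalEq.pullback (hψ : PullsBack ψ C.divisor C'.divisor) {z : C.total → ℂ}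
    {y : C'.total} (h : C.LocalEq z (ψ y)) : C'.LocalEq (z ∘ ψ) y where
  mem := hψ.preimage.subset h.mem
  hol := ContMDiffAt.comp y h.hol (ψ.contMDiff y)
  zero := by
    have : Tendsto ψ (𝓝[C'.divisor] y) (𝓝[C.divisor] (ψ y)) :=
      ψ.contMDiff.continuous.continuousWithinAt.tendsto_nhdsWithin
        fun _ hz => hψ.preimage.symm.subset hz
    exact this.eventually h.zero
  ne_zero := (tendsto_punct ψ hψ.preimage y).eventually h.ne_zero
  ideal_le := by
    refine (hψ.ideal_le y).trans ((Ideal.map_mono h.ideal_le).trans ?_)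
    rw [Ideal.map_span, Set.image_singleton]
    exact le_rfl

theorem HasPrincipalPart.pullback {k : ℕ} (hψ : ψ ⁻¹' C.divisor = C'.divisor)
    (hχ : ContMDiff T.I B.I ω χ)
    (hp : ∀ y, C.proj (ψ y) = χ (C'.proj y)) {z : C.total → ℂ} {y : C'.total}
    {m : PunctGerm C.total C.divisor (ψ y)} {c : Fin k → B → ℂ}
    (h : C.HasPrincipalPart z (ψ y) m c) :
    C'.HasPrincipalPart (z ∘ ψ) y (pullGerm ψ hψ y m) (fun j => c j ∘ χ) where
  hol j := by
    refine ContMDiffAt.comp _ ?_ (hχ (C'.proj y))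
    rw [← hp]
    exact h.hol j
  sub_mem := by
    have h1 := pullGerm_mem ψ hψ y h.sub_mem
    rw [map_sub, pullGerm_coe] at h1
    have e : C.polar z c ∘ ψ = C'.polar (z ∘ ψ) (fun j => c j ∘ χ) := by
      funext y
      simp only [PointedCurve.polar, Function.comp_apply, hp]
    rwa [e] at h1

end PointedCurve

/-! ### Coefficients of tails -/

namespace PointedCurve

variable {B : CplxMan.{u}} {k : ℕ}

open Classical in
/-- The values at `C.proj x` of the coefficients of the principal part of the germ `m` with respect
to the local equation `z`; zero if there is no principal part. -/
def coef (C : PointedCurve B) (z : C.total → ℂ) (x : C.total) (m : PunctGerm C.total C.divisor x) :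
    Fin k → ℂ :=
  if h : ∃ c : Fin k → B → ℂ, C.HasPrincipalPart z x m c then fun j => h.choose j (C.proj x) else 0

variable {C : PointedCurve B} {z w : C.total → ℂ} {x : C.total}

theorem HasPrincipalPart.coef_eq (hz : C.LocalEq z x) {m : PunctGerm C.total C.divisor x}
    {c : Fin k → B → ℂ} (h : C.HasPrincipalPart z x m c) :
    C.coef z x m = fun j => c j (C.proj x) := by
  have h1 : ∃ c : Fin k → B → ℂ, C.HasPrincipalPart z x m c := ⟨c, h⟩
  rw [coef, dif_pos h1]
  exact funext fun j => h1.choose_spec.unique hz h j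

/-- The coefficients at a point of the section of a tail, with respect to a local equation. -/
def tailCoef (hz : C.LocalEq z x) : TailStalk C.total C.divisor k x →ₗ[ℂ] (Fin k → ℂ) :=
  Submodule.liftQ _
    { toFun := fun m => C.coef z x m.1
      map_add' := fun m m' => by
        obtain ⟨c, hc⟩ := hz.exists_hasPrincipalPart m.2
        obtain ⟨c', hc'⟩ := hz.exists_hasPrincipalPart m'.2
        rw [hc.coef_eq hz, hc'.coef_eq hz]
        exact (hc.add hc').coef_eq hz
      map_smul' := fun a m => by
        obtain ⟨c, hc⟩ := hz.exists_hasPrincipalPart m.2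
        rw [hc.coef_eq hz]
        exact (hc.smul a).coef_eq hz }
    (fun m hm => (HasPrincipalPart.of_mem_holGerm (k := k) (z := z) hm).coef_eq hz)

theorem tailCoef_mk (hz : C.LocalEq z x) (m : poleGerm C.total C.divisor k x) :
    tailCoef hz (Submodule.Quotient.mk m) = C.coef z x m.1 := rfl

/-- Away from the section there are no tails. -/
theorem subsingleton_tailStalk (hx : x ∉ C.divisor) :
    Subsingleton (TailStalk C.total C.divisor k x) := by
  rw [Submodule.Quotient.subsingleton_iff, eq_top_iff]
  rintro m -
  have h1 : (1 : holGerm C.total C.divisor x) ∈ idealGerm C.total C.divisor x := by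
    refine ⟨fun _ => 1, contMDiffAt_const, ?_, rfl⟩
    have h3 : 𝓝[C.divisor] x = ⊥ := by
      rw [← not_neBot, ← mem_closure_iff_nhdsWithin_neBot, C.isClosed_divisor.closure_eq]
      exact hx
    rw [h3]; exact eventually_bot
  have h2 := m.2 _ (by simpa using Ideal.pow_mem_pow h1 k : (1 : holGerm _ _ _) ∈ _)
  rw [OneMemClass.coe_one, one_mul] at h2
  exact h2

/-- A germ of function on the complement of the section, seen as a tail when it has a pole of order
at most `k` (and zero otherwise). -/
def tailMk (C : PointedCurve B) (k : ℕ) (x : C.total) (m : PunctGerm C.total C.divisor x) :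
    TailStalk C.total C.divisor k x :=
  open Classical in if h : m ∈ poleGerm C.total C.divisor k x then Submodule.Quotient.mk ⟨m, h⟩
    else 0

theorem tailMk_of_mem {m : PunctGerm C.total C.divisor x}
    (h : m ∈ poleGerm C.total C.divisor k x) :
    C.tailMk k x m = Submodule.Quotient.mk ⟨m, h⟩ := dif_pos h

theorem tendsto_proj (C : PointedCurve B) (b : B) : Tendsto C.proj (𝓝 (C.sec b)) (𝓝 b) :=
  (C.proj.contMDiff.continuous.tendsto (C.sec b)).mono_right (congrArg 𝓝 (C.proj_sec b)).le

/-- The coefficients of a function with poles of bounded order vary holomorphically. -/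
theorem holAt_coef {f : C.total → ℂ} {b : B}
    (hf : (f : PunctGerm C.total C.divisor (C.sec b)) ∈ poleGerm C.total C.divisor k (C.sec b))
    (hz : ∀ᶠ b' in 𝓝 b, C.LocalEq z (C.sec b')) (j : Fin k) :
    HolAt (fun b' => C.coef z (C.sec b') (f : PunctGerm C.total C.divisor (C.sec b')) j) b := by
  obtain ⟨c, hc⟩ := hz.self_of_nhds.exists_hasPrincipalPart hf
  have h1 := hc.hol j
  have h2 := hc.eventually (C.sec_mem_divisor b)
  rw [C.proj_sec] at h1 h2
  refine ContMDiffAt.congr_of_eventuallyEq h1 ?_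
  filter_upwards [h2, hz] with b' h3 h4
  rw [h3.coef_eq h4, C.proj_sec]

/-- A function with poles of bounded order whose coefficients vanish is holomorphic. -/
theorem mem_holGerm_of_coef_eq_zero {f : C.total → ℂ} {b : B}
    (hf : (f : PunctGerm C.total C.divisor (C.sec b)) ∈ poleGerm C.total C.divisor k (C.sec b))
    (hz : ∀ᶠ b' in 𝓝 b, C.LocalEq z (C.sec b'))
    (h0 : ∀ᶠ b' in 𝓝 b,
      C.coef z (C.sec b') (f : PunctGerm C.total C.divisor (C.sec b')) = (0 : Fin k → ℂ)) :
    (f : PunctGerm C.total C.divisor (C.sec b)) ∈ holGerm C.total C.divisor (C.sec b) := by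
  obtain ⟨c, hc⟩ := hz.self_of_nhds.exists_hasPrincipalPart hf
  have h2 := hc.eventually (C.sec_mem_divisor b)
  rw [C.proj_sec] at h2
  have h3 : ∀ᶠ b' in 𝓝 b, ∀ j, c j b' = 0 := by
    filter_upwards [h2, hz, h0] with b' h3 h4 h5 j
    rw [h3.coef_eq h4] at h5
    simpa [C.proj_sec] using congrFun h5 j
  have hproj : Tendsto C.proj (𝓝[C.divisorᶜ] (C.sec b)) (𝓝 b) :=
    (C.tendsto_proj b).mono_left nhdsWithin_le_nhds
  have e : (C.polar z c : PunctGerm C.total C.divisor (C.sec b)) = 0 := by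
    refine Germ.coe_eq.2 ?_
    filter_upwards [hproj.eventually h3] with y hy
    simp [polar, hy]
  have h4 := hc.sub_mem
  rwa [e, sub_zero] at h4

/-- Polar functions have poles of bounded order at all points near the section. -/
theorem eventually_polar_mem_poleGerm {c : Fin k → B → ℂ} {b : B} (hc : ∀ j, HolAt (c j) b)
    (hz : ∀ᶠ b' in 𝓝 b, C.LocalEq z (C.sec b')) :
    ∀ᶠ y in 𝓝 (C.sec b),
      (C.polar z c : PunctGerm C.total C.divisor y) ∈ poleGerm C.total C.divisor k y := by
  have hproj := C.tendsto_proj b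
  have h0 := hz.self_of_nhds
  filter_upwards [hproj.eventually hz,
    hproj.eventually (eventually_all.2 fun j => (hc j).eventually),
    h0.hol.eventually, eventually_nhdsWithin_iff.1 h0.ne_zero] with y h1 h2 h3 h4
  by_cases hy : y ∈ C.divisor
  · rw [C.sec_proj_of_mem hy] at h1
    exact h1.mem_poleGerm (HasPrincipalPart.polar h2)
  · have h5 : HolAt (C.polar z c) y :=
      (ContMDiffAt.sum fun j _ => (holAt_comp_proj (h2 j)).mul (h3.pow j)).div₀ (h3.pow k)
        (pow_ne_zero k (h4 hy))
    exact fun a _ => mul_mem a.2 (mem_holGerm_of_holAt h5)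

/-- The matrix of the change of coefficients from the local equation `z` to the local equation
`w`. -/
def trans (C : PointedCurve B) (z w : C.total → ℂ) (x : C.total) (l j : Fin k) : ℂ :=
  C.coef w x (C.polar z (Pi.single l 1) : PunctGerm C.total C.divisor x) j

theorem holAt_single (l j : Fin k) (b : B) : HolAt (Pi.single (M := fun _ => B → ℂ) l 1 j) b := by
  rcases eq_or_ne j l with rfl | h
  · rw [Pi.single_eq_same]
    exact contMDiffAt_const
  · rw [Pi.single_eq_of_ne h]
    exact contMDiffAt_const

theorem LocalEq.polar_single_mem (hz : C.LocalEq z x) (l : Fin k) :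
    (C.polar z (Pi.single l 1) : PunctGerm C.total C.divisor x) ∈
      poleGerm C.total C.divisor k x :=
  hz.mem_poleGerm (HasPrincipalPart.polar fun j => holAt_single l j _)

theorem polar_eq_sum (c : Fin k → B → ℂ) :
    C.polar z c = ∑ l, (fun y => c l (C.proj y)) * C.polar z (Pi.single l 1) := by
  simp only [← polar_smul]
  rw [← polar_sum]
  congr 1
  funext j b
  simp [Finset.sum_apply, Pi.single_apply, apply_ite (fun f : B → ℂ => f b)]

/-- Change of local equation: as principal parts are linear over functions on the base, it is enough
to know the coefficients of the polar monomials. -/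
theorem tailCoef_eq_sum_trans (hz : C.LocalEq z x) (hw : C.LocalEq w x)
    (τ : TailStalk C.total C.divisor k x) (j : Fin k) :
    tailCoef hw τ j = ∑ l, tailCoef hz τ l * C.trans z w x l j := by
  obtain ⟨m, rfl⟩ := Submodule.Quotient.mk_surjective _ τ
  obtain ⟨c, hc⟩ := hz.exists_hasPrincipalPart m.2
  choose d hd using fun l : Fin k => hw.exists_hasPrincipalPart (hz.polar_single_mem l)
  have h1 := (HasPrincipalPart.sum Finset.univ fun l _ => (hd l).mul (hc.hol l)).add_holGerm
    hc.sub_mem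
  have e : ∑ l, (((fun y => c l (C.proj y) : C.total → ℂ) : PunctGerm C.total C.divisor x) *
      (C.polar z (Pi.single l 1) : PunctGerm C.total C.divisor x)) =
      (C.polar z c : PunctGerm C.total C.divisor x) := by
    rw [polar_eq_sum]
    exact (map_sum (Germ.coeAddHom (M := ℂ) (𝓝[C.divisorᶜ] x)) _ _).symm
  rw [e, add_sub_cancel] at h1
  rw [tailCoef_mk, tailCoef_mk, h1.coef_eq hw, hc.coef_eq hz]
  simp only [Finset.sum_apply, trans]
  exact Finset.sum_congr rfl fun l _ => by rw [(hd l).coef_eq hw]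

theorem trans_comp {w' : C.total → ℂ} (hz : C.LocalEq z x) (hw : C.LocalEq w x)
    (hw' : C.LocalEq w' x) (l j : Fin k) :
    C.trans z w' x l j = ∑ i, C.trans z w x l i * C.trans w w' x i j :=
  tailCoef_eq_sum_trans hw hw' (Submodule.Quotient.mk ⟨_, hz.polar_single_mem l⟩) j

theorem trans_self (hz : C.LocalEq z x) (l j : Fin k) :
    C.trans z z x l j = if j = l then 1 else 0 := by
  rw [trans, (HasPrincipalPart.polar fun j => holAt_single l j _).coef_eq hz]
  simp [Pi.single_apply, apply_ite (fun f : B → ℂ => f (C.proj x))]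

theorem holAt_trans {b : B} (hz : C.LocalEq z (C.sec b))
    (hw : ∀ᶠ b' in 𝓝 b, C.LocalEq w (C.sec b')) (l j : Fin k) :
    HolAt (fun b' => C.trans z w (C.sec b') l j) b :=
  holAt_coef (hz.polar_single_mem l) hw j

section Pullback

variable {T : CplxMan.{u}} {C' : PointedCurve T} {ψ : C'.total ⟶ C.total} {χ : T → B}

theorem coef_pullGerm (hψ : PullsBack ψ C.divisor C'.divisor) (hχ : ContMDiff T.I B.I ω χ)
    (hp : ∀ y, C.proj (ψ y) = χ (C'.proj y)) {y : C'.total} (hz : C.LocalEq z (ψ y))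
    {m : PunctGerm C.total C.divisor (ψ y)} (hm : m ∈ poleGerm C.total C.divisor k (ψ y)) :
    C'.coef (z ∘ ψ) y (pullGerm ψ hψ.preimage y m) = (C.coef z (ψ y) m : Fin k → ℂ) := by
  obtain ⟨c, hc⟩ := hz.exists_hasPrincipalPart hm
  rw [hc.coef_eq hz, (hc.pullback hψ.preimage hχ hp).coef_eq (hz.pullback hψ)]
  simp only [Function.comp_apply, hp]

theorem tailCoef_pullStalk (hψ : PullsBack ψ C.divisor C'.divisor) (hχ : ContMDiff T.I B.I ω χ)
    (hp : ∀ y, C.proj (ψ y) = χ (C'.proj y)) {y : C'.total} (hz : C.LocalEq z (ψ y))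
    (hz' : C'.LocalEq (z ∘ ψ) y) (τ : TailStalk C.total C.divisor k (ψ y)) :
    tailCoef hz' (pullStalk y k hψ τ) = tailCoef hz τ := by
  obtain ⟨m, rfl⟩ := Submodule.Quotient.mk_surjective _ τ
  exact coef_pullGerm hψ hχ hp hz m.2

theorem trans_pullback (hψ : PullsBack ψ C.divisor C'.divisor) (hχ : ContMDiff T.I B.I ω χ)
    (hp : ∀ y, C.proj (ψ y) = χ (C'.proj y)) {y : C'.total} (hz : C.LocalEq z (ψ y))
    (hw : C.LocalEq w (ψ y)) (l j : Fin k) :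
    C'.trans (z ∘ ψ) (w ∘ ψ) y l j = C.trans z w (ψ y) l j := by
  have h1 := coef_pullGerm hψ hχ hp hw (hz.polar_single_mem l)
  rw [pullGerm_coe] at h1
  have e : C.polar z (Pi.single l 1) ∘ ψ = C'.polar (z ∘ ψ) (Pi.single l 1) := by
    funext y
    simp [polar, Pi.single_apply, apply_ite (fun f : B → ℂ => f (C.proj (ψ y))),
      apply_ite (fun f : T → ℂ => f (C'.proj y))]
  rw [e] at h1
  exact congrFun h1 j

end Pullback

end PointedCurve

/-! ### Components of elements of a tensor product -/

section Components

variable {t : Type v} [AddCommGroup t] [Module ℂ t] {r : ℕ} (β : Module.Basis (Fin r) ℂ t)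
  {M N : Type*} [AddCommGroup M] [Module ℂ M] [AddCommGroup N] [Module ℂ N]

/-- The components of an element of `t ⊗ M` with respect to a basis of `t`. -/
def component (i : Fin r) : t ⊗[ℂ] M →ₗ[ℂ] M :=
  (TensorProduct.lid ℂ M).toLinearMap ∘ₗ (β.coord i).rTensor M

theorem component_tmul (i : Fin r) (a : t) (m : M) :
    component β i (a ⊗ₜ[ℂ] m) = β.repr a i • m := rfl

theorem component_lTensor (i : Fin r) (g : M →ₗ[ℂ] N) (m : t ⊗[ℂ] M) :
    component β i (g.lTensor t m) = g (component β i m) := by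
  induction m with
  | zero => simp
  | add m m' h h' => simp only [map_add, h, h']
  | tmul a m => simp [component_tmul]

theorem sum_tmul_component (m : t ⊗[ℂ] M) : ∑ i, β i ⊗ₜ[ℂ] component β i m = m := by
  induction m with
  | zero => simp
  | add m m' h h' => simp only [map_add, TensorProduct.tmul_add, Finset.sum_add_distrib, h, h']
  | tmul a m =>
    simp only [component_tmul, ← TensorProduct.smul_tmul]
    rw [← TensorProduct.sum_tmul, β.sum_repr]

theorem component_sum_tmul (m : Fin r → M) (i : Fin r) :
    component β i (∑ j, β j ⊗ₜ[ℂ] m j) = m i := by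
  simp [component_tmul, Finsupp.single_apply]

end Components

/-! ### Block diagonal maps -/

/-- The map of `ℂ ^ (r * k)`, read as `r` row vectors of length `k`, that multiplies each of them
by the matrix `M`. -/
def blockMap {k : ℕ} (r : ℕ) (M : Fin k → Fin k → ℂ) : (Fin (r * k) → ℂ) →L[ℂ] (Fin (r * k) → ℂ) :=
  ∑ l, ∑ j, M l j • ContinuousLinearMap.pi fun q : Fin (r * k) =>
    if (finProdFinEquiv.symm q).2 = j then
      ContinuousLinearMap.proj (R := ℂ) (φ := fun _ : Fin (r * k) => ℂ)
        (finProdFinEquiv ((finProdFinEquiv.symm q).1, l)) else 0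

theorem blockMap_apply {k : ℕ} (r : ℕ) (M : Fin k → Fin k → ℂ) (v : Fin (r * k) → ℂ) (i : Fin r)
    (j : Fin k) :
    blockMap r M v (finProdFinEquiv (i, j)) = ∑ l, v (finProdFinEquiv (i, l)) * M l j := by
  have h (a : Fin k) (f : (Fin (r * k) → ℂ) →L[ℂ] ℂ) :
      (if j = a then f else 0) v = if j = a then f v else 0 := by split_ifs <;> rfl
  simp only [blockMap, sum_apply, _root_.smul_apply, Finset.sum_apply,
    Pi.smul_apply, ContinuousLinearMap.coe_pi', Equiv.symm_apply_apply, h,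
    ContinuousLinearMap.proj_apply, smul_eq_mul, mul_ite, mul_zero, Finset.sum_ite_eq,
    Finset.mem_univ, if_true, mul_comm]

theorem contMDiffAt_blockMap {B : CplxMan.{u}} {k r : ℕ} {M : B → Fin k → Fin k → ℂ} {b : B}
    (hM : ∀ l j, HolAt (fun b => M b l j) b) :
    ContMDiffAt B.I 𝓘(ℂ, (Fin (r * k) → ℂ) →L[ℂ] (Fin (r * k) → ℂ)) ω
      (fun b => blockMap r (M b)) b :=
  ContMDiffAt.sum fun l _ => ContMDiffAt.sum fun j _ => (hM l j).smul contMDiffAt_const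

/-! ### The bundle of principal parts -/

namespace PointedCurve

/-- A covering of the base by open sets `dom i`, with a function `z i` that is a local equation of
the section at all its points over `dom i`; the index `idx b` of a preferred member of the covering
is chosen at every `b`. -/
structure Frame {B : CplxMan.{u}} (C : PointedCurve B) (ι : Type u) where
  z : ι → C.total → ℂ
  dom : ι → Set B
  isOpen_dom : ∀ i, IsOpen (dom i)
  idx : B → ι
  mem_dom : ∀ b, b ∈ dom (idx b)
  localEq : ∀ {i b}, b ∈ dom i → C.LocalEq (z i) (C.sec b)

namespace Frame

variable {B : CplxMan.{u}} {C : PointedCurve B} {ι : Type u} (F : C.Frame ι)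

theorem eventually_localEq {i : ι} {b : B} (hb : b ∈ F.dom i) :
    ∀ᶠ b' in 𝓝 b, C.LocalEq (F.z i) (C.sec b') :=
  ((F.isOpen_dom i).eventually_mem hb).mono fun _ => F.localEq

/-- The change of coordinates between the `i`-th and the `j`-th local equation, on `r`-tuples of
principal parts. -/
def change (k r : ℕ) (i j : ι) (b : B) : (Fin (r * k) → ℂ) →L[ℂ] (Fin (r * k) → ℂ) :=
  blockMap r (C.trans (F.z i) (F.z j) (C.sec b))

theorem ext_finProd {r k : ℕ} {v w : Fin (r * k) → ℂ}
    (h : ∀ i j, v (finProdFinEquiv (i, j)) = w (finProdFinEquiv (i, j))) : v = w := by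
  funext q
  have := h (finProdFinEquiv.symm q).1 (finProdFinEquiv.symm q).2
  rwa [Prod.mk.eta, Equiv.apply_symm_apply] at this

theorem change_self (k r : ℕ) {i : ι} {b : B} (hb : b ∈ F.dom i) (v : Fin (r * k) → ℂ) :
    F.change k r i i b v = v := by
  refine ext_finProd fun a j => ?_
  simp [change, blockMap_apply, trans_self (F.localEq hb)]

theorem change_change (k r : ℕ) {i j l : ι} {b : B} (hi : b ∈ F.dom i) (hj : b ∈ F.dom j)
    (hl : b ∈ F.dom l) (v : Fin (r * k) → ℂ) :
    F.change k r j l b (F.change k r i j b v) = F.change k r i l b v := by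
  refine ext_finProd fun a m => ?_
  simp only [change, blockMap_apply, Finset.sum_mul,
    trans_comp (F.localEq hi) (F.localEq hj) (F.localEq hl), Finset.mul_sum]
  rw [Finset.sum_comm]
  simp only [mul_assoc]

theorem contMDiffOn_change (k r : ℕ) (i j : ι) :
    ContMDiffOn B.I 𝓘(ℂ, (Fin (r * k) → ℂ) →L[ℂ] (Fin (r * k) → ℂ)) ω (F.change k r i j)
      (F.dom i ∩ F.dom j) := fun _ hb =>
  (contMDiffAt_blockMap fun l m => holAt_trans (F.localEq hb.1) (F.eventually_localEq hb.2)
    l m).contMDiffWithinAt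

/-- The gluing data of the bundle of `r`-tuples of principal parts of order `k`. -/
def core (k r : ℕ) : VectorBundleCore ℂ B (Fin (r * k) → ℂ) ι where
  baseSet := F.dom
  isOpen_baseSet := F.isOpen_dom
  indexAt := F.idx
  mem_baseSet_at := F.mem_dom
  coordChange := F.change k r
  coordChange_self _ _ hb v := F.change_self k r hb v
  continuousOn_coordChange i j := (F.contMDiffOn_change k r i j).continuousOn
  coordChange_comp _ _ _ _ hb v := F.change_change k r hb.1.1 hb.1.2 hb.2 v

instance (k r : ℕ) : (F.core k r).IsContMDiff B.I ω := ⟨F.contMDiffOn_change k r⟩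

/-- The bundle of `r`-tuples of principal parts of order `k`. -/
def bundle (k r : ℕ) : HolVectorBundle B (r * k) where
  fibre := (F.core k r).Fiber

/-! ### Sections of the sheaf of tails in coordinates -/

variable {k r : ℕ} {t : Type v} [AddCommGroup t] [Module ℂ t] (β : Module.Basis (Fin r) ℂ t)

/-- The coordinates at the point `C.sec b` of an element of the stalk of `t ⊗ (𝒪(kσ) / 𝒪)`, with
respect to a basis of `t` and a local equation. -/
def stalkCoord {z : C.total → ℂ} {x : C.total} (hz : C.LocalEq z x) :
    t ⊗[ℂ] TailStalk C.total C.divisor k x →ₗ[ℂ] (Fin (r * k) → ℂ) :=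
  LinearMap.pi fun q => LinearMap.proj (finProdFinEquiv.symm q).2 ∘ₗ tailCoef hz ∘ₗ
    component β (finProdFinEquiv.symm q).1

theorem stalkCoord_apply {z : C.total → ℂ} {x : C.total} (hz : C.LocalEq z x)
    (m : t ⊗[ℂ] TailStalk C.total C.divisor k x) (i : Fin r) (j : Fin k) :
    stalkCoord β hz m (finProdFinEquiv (i, j)) = tailCoef hz (component β i m) j := by
  simp only [stalkCoord, LinearMap.pi_apply, LinearMap.comp_apply, LinearMap.proj_apply,
    Equiv.symm_apply_apply]

theorem change_stalkCoord {i j : ι} {b : B} (hi : b ∈ F.dom i) (hj : b ∈ F.dom j)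
    (m : t ⊗[ℂ] TailStalk C.total C.divisor k (C.sec b)) :
    F.change k r i j b (stalkCoord β (F.localEq hi) m) = stalkCoord β (F.localEq hj) m := by
  refine ext_finProd fun a l => ?_
  rw [change, blockMap_apply, stalkCoord_apply, tailCoef_eq_sum_trans (F.localEq hi) (F.localEq hj)]
  simp only [stalkCoord_apply]

/-- The coordinates of a section of `t ⊗ (𝒪(kσ) / 𝒪)`, as a function on the base: at each point
they are taken with respect to the preferred local equation. -/
def coords : tailSections C.total C.divisor k t →ₗ[ℂ] (B → Fin (r * k) → ℂ) where
  toFun s b := stalkCoord β (F.localEq (F.mem_dom b)) (s.1 (C.sec b))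
  map_add' _ _ := funext fun _ => map_add _ _ _
  map_smul' c _ := funext fun b => (stalkCoord β (F.localEq (F.mem_dom b))).map_smul c _

theorem coords_apply (s : tailSections C.total C.divisor k t) (b : B) :
    F.coords β s b = stalkCoord β (F.localEq (F.mem_dom b)) (s.1 (C.sec b)) := rfl

variable {β} in
/-- Locally, the components of a section are tails of functions. -/
theorem exists_component_eq (s : tailSections C.total C.divisor k t) (x : C.total) :
    ∃ U : Set C.total, IsOpen U ∧ x ∈ U ∧ ∃ f : Fin r → C.total → ℂ,
      ∀ i, ∀ y ∈ U, ∃ hf : (f i : PunctGerm C.total C.divisor y) ∈ poleGerm C.total C.divisor k y,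
        component β i (s.1 y) = Submodule.Quotient.mk ⟨_, hf⟩ := by
  obtain ⟨U, hU, hx, p, hp⟩ := s.2 x
  refine ⟨U, hU, hx, fun i => (component β i p).1, fun i y hy => ⟨(component β i p).2 y hy, ?_⟩⟩
  rw [hp y hy, component_lTensor]
  rfl

theorem exists_component_sec_eq (s : tailSections C.total C.divisor k t) (b : B) :
    ∃ f : Fin r → C.total → ℂ, ∀ i, ∀ᶠ b' in 𝓝 b,
      ∃ hf : (f i : PunctGerm C.total C.divisor (C.sec b')) ∈
        poleGerm C.total C.divisor k (C.sec b'),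
        component β i (s.1 (C.sec b')) = Submodule.Quotient.mk ⟨_, hf⟩ := by
  obtain ⟨U, hU, hx, f, hf⟩ := exists_component_eq (β := β) s (C.sec b)
  exact ⟨f, fun i => (C.sec.contMDiff.continuous.continuousAt.eventually_mem
    (hU.mem_nhds hx)).mono fun b' hb' => hf i _ hb'⟩

/-- A function on the base with values in `ℂ ^ (r * k)` is a holomorphic section of the bundle of
principal parts at `b`: it becomes holomorphic in the preferred coordinates at `b`. -/
def HolSectionAt (v : B → Fin (r * k) → ℂ) (b : B) : Prop :=
  ∀ q, HolAt (fun b' => F.change k r (F.idx b') (F.idx b) b' (v b') q) b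

theorem holSectionAt_coords (s : tailSections C.total C.divisor k t) (b : B) :
    F.HolSectionAt (F.coords β s) b := by
  intro q
  obtain ⟨⟨i, j⟩, rfl⟩ := finProdFinEquiv.surjective q
  obtain ⟨f, hf⟩ := exists_component_sec_eq β s b
  refine ContMDiffAt.congr_of_eventuallyEq (holAt_coef (hf i).self_of_nhds.1
    (F.eventually_localEq (F.mem_dom b)) j) ?_
  filter_upwards [hf i, (F.isOpen_dom _).eventually_mem (F.mem_dom b)] with b' h1 h2
  obtain ⟨h1, h3⟩ := h1
  rw [coords_apply, F.change_stalkCoord β (F.mem_dom b') h2, stalkCoord_apply, h3, tailCoef_mk]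

theorem coords_injective :
    Function.Injective (F.coords β : tailSections C.total C.divisor k t → _) := by
  refine (injective_iff_map_eq_zero _).2 fun s hs => Subtype.ext (funext fun x => ?_)
  by_cases hx : x ∈ C.divisor
  swap
  · have := subsingleton_tailStalk (k := k) hx
    exact Subsingleton.elim _ _
  obtain ⟨b, rfl⟩ := hx
  rw [← sum_tmul_component β (s.1 (C.sec b))]
  refine Finset.sum_eq_zero fun i _ => ?_
  obtain ⟨f, hf⟩ := exists_component_sec_eq β s b
  obtain ⟨h1, h2⟩ := (hf i).self_of_nhds
  have h3 := mem_holGerm_of_coef_eq_zero h1 (F.eventually_localEq (F.mem_dom b)) (by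
    filter_upwards [hf i, (F.isOpen_dom _).eventually_mem (F.mem_dom b)] with b' h4 h5
    obtain ⟨h4, h6⟩ := h4
    funext j
    have h7 := F.change_stalkCoord β (F.mem_dom b') h5 (s.1 (C.sec b'))
    rw [← coords_apply, hs, Pi.zero_apply, map_zero] at h7
    have h8 := congrFun h7 (finProdFinEquiv (i, j))
    rw [stalkCoord_apply, h6, tailCoef_mk] at h8
    exact h8.symm)
  have h4 : (Submodule.Quotient.mk ⟨_, h1⟩ : TailStalk C.total C.divisor k (C.sec b)) = 0 :=
    (Submodule.Quotient.mk_eq_zero _).2 h3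
  rw [h2, h4, TensorProduct.tmul_zero]

end Frame
end PointedCurve

/-! ### Gluing tails from coordinates -/

namespace PointedCurve
namespace Frame

variable {B : CplxMan.{u}} {C : PointedCurve B} {ι : Type u} (F : C.Frame ι)
  {k r : ℕ} {t : Type v} [AddCommGroup t] [Module ℂ t] (β : Module.Basis (Fin r) ℂ t)

/-- Every holomorphic section of the bundle of principal parts comes from a section of
`t ⊗ (𝒪(kσ) / 𝒪)`: near `C.sec b` one takes the polar functions in the preferred local equation at
`b`, and these agree modulo holomorphic functions because they have the same coefficients. -/
theorem exists_coords_eq {v : B → Fin (r * k) → ℂ} (hv : ∀ b, F.HolSectionAt v b) :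
    ∃ s : tailSections C.total C.divisor k t, F.coords β s = v := by
  let u : B → B → Fin (r * k) → ℂ := fun b b' => F.change k r (F.idx b') (F.idx b) b' (v b')
  let f : B → Fin r → C.total → ℂ := fun b i =>
    C.polar (F.z (F.idx b)) fun (j : Fin k) b' => u b b' (finProdFinEquiv (i, j))
  have hu : ∀ b, ∀ᶠ b' in 𝓝 b, ∀ q, HolAt (fun b'' => u b b'' q) b' := fun b =>
    eventually_all.2 fun q => (hv b q).eventually
  have hP : ∀ b i b', (∀ q, HolAt (fun b'' => u b b'' q) b') →
      C.HasPrincipalPart (F.z (F.idx b)) (C.sec b')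
        (f b i : PunctGerm C.total C.divisor (C.sec b'))
        (fun (j : Fin k) b' => u b b' (finProdFinEquiv (i, j))) := fun b i b' h =>
    HasPrincipalPart.polar fun j => by rw [C.proj_sec]; exact h _
  have hmem : ∀ b i b', b' ∈ F.dom (F.idx b) → (∀ q, HolAt (fun b'' => u b b'' q) b') →
      (f b i : PunctGerm C.total C.divisor (C.sec b')) ∈
        poleGerm C.total C.divisor k (C.sec b') := fun b i b' h1 h2 =>
    (F.localEq h1).mem_poleGerm (hP b i b' h2)
  have hself : ∀ b, ∀ q, HolAt (fun b'' => u b b'' q) b := fun b => (hu b).self_of_nhds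
  -- the polar functions chosen at `b` and at `b'` induce the same tail at `C.sec b'`
  have hglue : ∀ b i b', b' ∈ F.dom (F.idx b) → (∀ q, HolAt (fun b'' => u b b'' q) b') →
      (f b i : PunctGerm C.total C.divisor (C.sec b')) - f b' i ∈
        holGerm C.total C.divisor (C.sec b') := by
    intro b i b' h1 h2
    refine mem_holGerm_of_coef_eq_zero (f := f b i - f b' i) (k := k)
      (sub_mem (hmem b i b' h1 h2) (hmem b' i b' (F.mem_dom b') (hself b')))
      (F.eventually_localEq (F.mem_dom b')) ?_
    -- both functions have the same coefficients in the local equation preferred at `b'`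
    filter_upwards [(F.isOpen_dom _).eventually_mem h1, hu b',
      (F.isOpen_dom _).eventually_mem (F.mem_dom b'),
      eventually_all.2 fun q => (h2 q).eventually] with b'' h3 h4 h5 h6
    have e : C.coef (F.z (F.idx b')) (C.sec b'')
        ((f b i - f b' i : C.total → ℂ) : PunctGerm C.total C.divisor (C.sec b'')) =
        tailCoef (F.localEq h5) (Submodule.Quotient.mk ⟨_, hmem b i b'' h3 h6⟩) -
        tailCoef (F.localEq h5) (Submodule.Quotient.mk ⟨_, hmem b' i b'' h5 h4⟩) := by
      rw [← map_sub]
      rfl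
    rw [e]
    funext j
    have e1 := F.change_change k r (F.mem_dom b'') h3 h5 (v b'')
    have e2 := congrFun e1 (finProdFinEquiv (i, j))
    rw [change, blockMap_apply] at e2
    rw [Pi.sub_apply, tailCoef_eq_sum_trans (F.localEq h3) (F.localEq h5), tailCoef_mk,
      tailCoef_mk, (hP b i b'' h6).coef_eq (F.localEq h3),
      (hP b' i b'' h4).coef_eq (F.localEq h5), C.proj_sec]
    exact sub_eq_zero.2 e2
  let σ : ∀ x : C.total, t ⊗[ℂ] TailStalk C.total C.divisor k x := fun x =>
    ∑ i, β i ⊗ₜ[ℂ] C.tailMk k x (f (C.proj x) i)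
  have hσ : σ ∈ tailSections C.total C.divisor k t := by
    intro x
    by_cases hx : x ∈ C.divisor
    swap
    · refine ⟨C.divisorᶜ, C.isClosed_divisor.isOpen_compl, hx, 0, fun y hy => ?_⟩
      have := subsingleton_tailStalk (k := k) hy
      exact Subsingleton.elim _ _
    obtain ⟨b, rfl⟩ := hx
    have h1 : ∀ᶠ y in 𝓝 (C.sec b), (∀ i, (f b i : PunctGerm C.total C.divisor y) ∈
        poleGerm C.total C.divisor k y) ∧ C.proj y ∈ F.dom (F.idx b) ∧
        ∀ q, HolAt (fun b'' => u b b'' q) (C.proj y) :=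
      (eventually_all.2 fun i => eventually_polar_mem_poleGerm (fun j => hself b _)
        (F.eventually_localEq (F.mem_dom b))).and
        ((C.tendsto_proj b).eventually (((F.isOpen_dom _).eventually_mem (F.mem_dom b)).and (hu b)))
    obtain ⟨U, hU, hUo, hbU⟩ := eventually_nhds_iff.1 h1
    refine ⟨U, hUo, hbU, ∑ i, β i ⊗ₜ[ℂ] ⟨f b i, fun y hy => (hU y hy).1 i⟩, fun y hy => ?_⟩
    rw [map_sum]
    refine Finset.sum_congr rfl fun i _ => ?_
    rw [LinearMap.lTensor_tmul]
    congr 1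
    by_cases hyD : y ∈ C.divisor
    swap
    · have := subsingleton_tailStalk (k := k) hyD
      exact Subsingleton.elim _ _
    obtain ⟨b', rfl⟩ := hyD
    have h2 := (hU _ hy).2
    rw [C.proj_sec] at h2 ⊢
    rw [tailMk_of_mem (hmem b' i b' (F.mem_dom b') (hself b'))]
    exact ((Submodule.Quotient.eq _).2 (hglue b i b' h2.1 h2.2)).symm
  refine ⟨⟨σ, hσ⟩, funext fun b => ext_finProd fun i j => ?_⟩
  rw [coords_apply, stalkCoord_apply, component_sum_tmul, C.proj_sec,
    tailMk_of_mem (hmem b i b (F.mem_dom b) (hself b)), tailCoef_mk,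
    (hP b i b (hself b)).coef_eq (F.localEq (F.mem_dom b)), C.proj_sec]
  exact congrFun (F.change_self k r (F.mem_dom b) (v b)) _

/-! ### Base change of frames -/

variable {T T' : CplxMan.{u}}

/-- The frame of a base change, obtained by pulling back local equations. -/
def pull (φ : T ⟶ B) : (C.pullback φ).Frame ι where
  z i := F.z i ∘ C.toTotal φ
  dom i := φ ⁻¹' F.dom i
  isOpen_dom i := (F.isOpen_dom i).preimage φ.contMDiff.continuous
  idx s := F.idx (φ s)
  mem_dom s := F.mem_dom (φ s)
  localEq {_ s} h :=
    LocalEq.pullback (C.pullsBack_toTotal φ) (y := (C.pullback φ).sec s) (F.localEq h)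

theorem proj_toTotal (φ : T ⟶ B) (y : (C.pullback φ).total) :
    C.proj (C.toTotal φ y) = φ ((C.pullback φ).proj y) :=
  (CplxMan.FibreProd.eq (φ := φ) (π := C.proj) y).symm

theorem change_pull (φ : T ⟶ B) {i j : ι} {s : T} (hi : φ s ∈ F.dom i) (hj : φ s ∈ F.dom j) :
    (F.pull φ).change k r i j s = F.change k r i j (φ s) :=
  congrArg (blockMap r) (funext fun l => funext fun m =>
    trans_pullback (C.pullsBack_toTotal φ) φ.contMDiff (proj_toTotal φ)
      (y := (C.pullback φ).sec s) (F.localEq hi) (F.localEq hj) l m)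

/-- Coordinates of sections are compatible with base change. -/
theorem coords_pullTails {φ : T ⟶ B} {φ' : T' ⟶ B} (χ : T' ⟶ T) (h : χ ≫ φ = φ')
    (s : tailSections (C.pullback φ).total (C.pullback φ).divisor k t) (a : T') :
    (F.pull φ').coords β (pullTails k t (C.pullsBack_baseChangeMap χ h) s) a =
      (F.pull φ).coords β s (χ a) := by
  subst h
  refine ext_finProd fun i j => ?_
  rw [coords_apply, coords_apply, stalkCoord_apply, stalkCoord_apply]
  have h1 : component β i ((pullTails k t (C.pullsBack_baseChangeMap χ rfl) s).1
      ((C.pullback (χ ≫ φ)).sec a)) =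
      pullStalk ((C.pullback (χ ≫ φ)).sec a) k (C.pullsBack_baseChangeMap χ rfl)
        (component β i (s.1 ((C.pullback φ).sec (χ a)))) :=
    component_lTensor β i _ _
  rw [h1]
  exact congrFun (tailCoef_pullStalk (C.pullsBack_baseChangeMap χ rfl) χ.contMDiff
    (fun _ => rfl) (y := (C.pullback (χ ≫ φ)).sec a)
    ((F.pull φ).localEq ((F.pull φ).mem_dom (χ a))) _ _) j

/-- Holomorphic maps to the bundle of principal parts, in coordinates. -/
theorem contMDiff_mk_iff (φ : T ⟶ B) (v : T → Fin (r * k) → ℂ) :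
    ContMDiff T.I (B.I.prod 𝓘(ℂ, Fin (r * k) → ℂ)) ω
      (fun s => (⟨φ s, v s⟩ : Bundle.TotalSpace (Fin (r * k) → ℂ) (F.core k r).Fiber)) ↔
    ∀ s, (F.pull φ).HolSectionAt v s := by
  refine forall_congr' fun s => ?_
  refine Bundle.contMDiffAt_totalSpace.trans ((and_iff_right (φ.contMDiff s)).trans
    (contMDiffAt_pi_space.trans (forall_congr' fun q =>
      Filter.EventuallyEq.contMDiffAt_iff ?_)))
  filter_upwards [((F.pull φ).isOpen_dom _).eventually_mem ((F.pull φ).mem_dom s)] with s' hs'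
  exact congrFun (DFunLike.congr_fun
    (F.change_pull φ (i := F.idx (φ s')) (F.mem_dom (φ s')) hs').symm (v s')) q

/-! ### Representability -/

/-- The map to the bundle of principal parts given by a section of `t ⊗ (𝒪(kσ) / 𝒪)` on a base
change of the family. -/
def toHom (X : Over B)
    (s : tailSections (C.pullback X.hom).total (C.pullback X.hom).divisor k t) :
    X ⟶ Over.mk (F.bundle k r).proj :=
  Over.homMk (U := X) (V := Over.mk (F.bundle k r).proj)
    (⟨fun a => (⟨X.hom a, (F.pull X.hom).coords β s a⟩ :
      Bundle.TotalSpace (Fin (r * k) → ℂ) (F.core k r).Fiber),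
      (F.contMDiff_mk_iff X.hom _).2 ((F.pull X.hom).holSectionAt_coords β s)⟩)
    (CplxMan.hom_ext fun _ => rfl)

theorem toHom_apply (X : Over B)
    (s : tailSections (C.pullback X.hom).total (C.pullback X.hom).divisor k t) (a : X.left) :
    (F.toHom β X s).left a = (⟨X.hom a, (F.pull X.hom).coords β s a⟩ :
      Bundle.TotalSpace (Fin (r * k) → ℂ) (F.core k r).Fiber) := rfl

/-- A map over the base to the bundle of principal parts, written in coordinates. -/
theorem hom_apply (X : Over B) (h : X ⟶ Over.mk (F.bundle k r).proj) :
    ∃ v : X.left → Fin (r * k) → ℂ, ∀ a, h.left a = (⟨X.hom a, v a⟩ :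
      Bundle.TotalSpace (Fin (r * k) → ℂ) (F.core k r).Fiber) := by
  have key : ∀ a, ∃ v : Fin (r * k) → ℂ, h.left a = (⟨X.hom a, v⟩ :
      Bundle.TotalSpace (Fin (r * k) → ℂ) (F.core k r).Fiber) := by
    intro a
    have h1 : ((F.bundle k r).proj (h.left a)) = X.hom a := DFunLike.congr_fun (Over.w h) a
    generalize h.left a = p at h1
    obtain ⟨b, w⟩ : Bundle.TotalSpace (Fin (r * k) → ℂ) (F.core k r).Fiber := p
    have h2 : b = X.hom a := h1
    subst h2
    exact ⟨w, rfl⟩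
  choose v hv using key
  exact ⟨v, hv⟩

theorem toHom_bijective (X : Over B) : Function.Bijective (F.toHom (k := k) β X) := by
  constructor
  · intro s s' h
    refine (F.pull X.hom).coords_injective β (funext fun a => ?_)
    have h1 : (F.toHom β X s).left a = (F.toHom β X s').left a := by rw [h]
    rw [toHom_apply, toHom_apply] at h1
    exact Bundle.TotalSpace.mk_inj.1 h1
  · intro h
    obtain ⟨v, hv⟩ := F.hom_apply X h
    let g : X.left ⟶ (F.bundle k r).total := h.left
    have h1 : ∀ f : X.left → Bundle.TotalSpace (Fin (r * k) → ℂ) (F.core k r).Fiber,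
        (∀ a, g a = f a) → ContMDiff X.left.I (B.I.prod 𝓘(ℂ, Fin (r * k) → ℂ)) ω f := by
      intro f hf
      have e : f = fun a => g a := funext fun a => (hf a).symm
      subst e
      exact g.contMDiff
    obtain ⟨s, hs⟩ := (F.pull X.hom).exists_coords_eq β
      ((F.contMDiff_mk_iff X.hom v).1 (h1 _ hv))
    refine ⟨s, Over.OverMorphism.ext (CplxMan.hom_ext fun a => ?_)⟩
    rw [toHom_apply, hs]
    exact (hv a).symm

theorem toHom_pullTails {X X' : Over B} (f : X' ⟶ X)
    (s : tailSections (C.pullback X.hom).total (C.pullback X.hom).divisor k t) :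
    F.toHom β X' (pullTails k t (C.pullsBack_baseChangeMap f.left (Over.w f)) s) =
      f ≫ F.toHom β X s := by
  obtain ⟨v, hv⟩ := F.hom_apply X' (f ≫ F.toHom β X s)
  refine Over.OverMorphism.ext (CplxMan.hom_ext fun a => ?_)
  rw [toHom_apply, coords_pullTails]
  have h1 : X'.hom a = X.hom (f.left a) := (DFunLike.congr_fun (Over.w f) a).symm
  rw [h1]
  rfl

/-- The functor of irregular types is represented by the bundle of principal parts. -/
def representableBy :
    (C.irregularTypes t k ⋙ forget (ModuleCat.{max u v} ℂ)).RepresentableBy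
      (Over.mk (F.bundle k r).proj) where
  homEquiv {X} := (Equiv.ofBijective _ (F.toHom_bijective (k := k) β X)).symm
  homEquiv_comp {X' X} f g := by
    refine (Equiv.symm_apply_eq _).2 ?_
    refine Eq.trans ?_ (F.toHom_pullTails β f _).symm
    exact congrArg (f ≫ ·) ((Equiv.ofBijective _ (F.toHom_bijective (k := k) β X)).apply_symm_apply
      g).symm

theorem toHom_homEquiv (X : Over B) (h : X ⟶ Over.mk (F.bundle k r).proj) :
    F.toHom β X ((F.representableBy β).homEquiv h) = h :=
  (Equiv.ofBijective _ (F.toHom_bijective (k := k) β X)).apply_symm_apply h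

/-- A linear combination in a fibre of the bundle, read off in the preferred coordinates. -/
theorem eq_of_mk_eq (c : ℂ) {b b' : B} {v₁ v₂ v₃ : Fin (r * k) → ℂ}
    {v w : (F.bundle k r).fibre b'}
    (e₁ : (⟨b, v₁⟩ : Bundle.TotalSpace (Fin (r * k) → ℂ) (F.core k r).Fiber) = ⟨b', v⟩)
    (e₂ : (⟨b, v₂⟩ : Bundle.TotalSpace (Fin (r * k) → ℂ) (F.core k r).Fiber) = ⟨b', w⟩)
    (e₃ : (⟨b, v₃⟩ : Bundle.TotalSpace (Fin (r * k) → ℂ) (F.core k r).Fiber) =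
      ⟨b', c • v + w⟩) : v₃ = c • v₁ + v₂ := by
  cases e₁
  cases e₂
  cases e₃
  rfl

/-- The correspondence between sections and maps to the bundle is linear. -/
theorem eq_of_isLinComb (X : Over B) (c : ℂ)
    {s₁ s₂ s₃ : tailSections (C.pullback X.hom).total (C.pullback X.hom).divisor k t}
    (h : HolVectorBundle.IsLinComb c (F.toHom β X s₁) (F.toHom β X s₂) (F.toHom β X s₃)) :
    s₃ = c • s₁ + s₂ := by
  refine (F.pull X.hom).coords_injective β (funext fun a => ?_)
  rw [map_add, map_smul]
  obtain ⟨b, v, w, e₁, e₂, e₃⟩ := h a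
  exact F.eq_of_mk_eq c e₁ e₂ e₃

end Frame

/-- The frame given by the fibre coordinates of the charts around the points of the section. -/
def coordFrame {B : CplxMan.{u}} (C : PointedCurve B) : C.Frame B where
  z := C.coord
  dom := C.coordSet
  isOpen_dom := C.isOpen_coordSet
  idx b := b
  mem_dom := C.mem_coordSet
  localEq := C.localEq_coord

end PointedCurve

end

theorem mainTheorem4 {B : CplxMan.{u}} (C : PointedCurve B) (k : ℕ)
    (t : Type v) [AddCommGroup t] [Module ℂ t] [FiniteDimensional ℂ t] :
    ∃ (V : HolVectorBundle B (Module.finrank ℂ t * k))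
      (R : (C.irregularTypes t k ⋙ forget (ModuleCat.{max u v} ℂ)).RepresentableBy
        (Over.mk V.proj)),
      ∀ (X : Over B),
        let e : (X ⟶ Over.mk V.proj) → (C.irregularTypes t k).obj (op X) := fun h => R.homEquiv h
        ∀ (c : ℂ) (h₁ h₂ h₃ : X ⟶ Over.mk V.proj),
          HolVectorBundle.IsLinComb c h₁ h₂ h₃ → e h₃ = c • e h₁ + e h₂ := by
  let F := C.coordFrame
  let β := Module.finBasis ℂ t
  refine ⟨F.bundle k _, F.representableBy β, ?_⟩
  intro X e c h₁ h₂ h₃ hlin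
  refine F.eq_of_isLinComb β X c ?_
  rwa [F.toHom_homEquiv β X h₁, F.toHom_homEquiv β X h₂, F.toHom_homEquiv β X h₃]
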